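/- Let $d\ge 1$, $Q_d:=(-\pi,\pi)^d$ and $\omega(x):=\sum_{j=1}^d\sin^2(x_j/2)$. For integers $k\le 0$ put $$H(k,d)^{-1}:=\sum_{j=0}^{-k}d^{\,j}\,a(k+j,d)\prod_{i=0}^{j-1}b(k+i,d)+d^{-k}\prod_{i=0}^{-k}b(k+i,d),\qquad a(k,d):=\frac{16}{(d+2k-2)^2},\quad b(k,d):=\frac{3d+2k-2}{d(d+2k-2)},$$ $$HR(k,d)^{-1}:=\sum_{j=0}^{-k}d^{\,j}\,a'(k+j,d)\prod_{i=0}^{j-1}b'(k+i,d)+d^{-k}\prod_{i=0}^{-k}b'(k+i,d),\qquad a'(k,d):=\frac{16}{(d-2k)^2},\quad b'(k,d):=\frac{3d-2k+4}{d(d-2k)},$$ $$R(k,d):=\frac{(d-2k)^2(d+2k-4)^2}{256\Big(1+HR(k,d)^{-1}\big(d\,C_1(k/2,d)+d\,C_2(k/2,d)\,H(k,d)^{-1}\big)\Big)},$$ where, with $\beta=\beta(\alpha,d):=\frac18\Big(-4+8\alpha+\sqrt2\,\sqrt{d^2-4d+16\alpha^2-16\alpha+8}\Big)$, $$C_1(\alpha,d):=\frac{2\beta(d-2\beta+2\alpha-1)}{d},\qquad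 C_2(\alpha,d):=\frac{\beta(d+4\beta-4\alpha)(d+2\alpha-2)(2\beta-2\alpha+1)}{2d}.$$ For integers $m\ge 0$ set $$C(m,d):=\prod_{i=0}^{m-1}R(-2i,d),\qquad \widetilde C(m,d):=H(0,d)\prod_{i=0}^{m-1}R(-2i-1,d).$$ Let $\psi\in C^\infty(\overline{Q_d};\mathbb C)$ be such that $\psi$ and all its derivatives are $2\pi$-periodic in each variable (they take equal values at opposite points of the faces $x_i=-\pi$ and $x_i=\pi$, for every $i$), and $\int_{Q_d}\psi\,dx=0$. Let $m\ge 0$ be an integer. 1. If $d>4m$, then $|\psi|^2/\omega^{2m}$ is integrable on $Q_d$ and $$C(m,d)\int_{Q_d}\frac{|\psi(x)|^2}{\omega(x)^{2m}}\,dx\le\int_{Q_d}|\Delta^m\psi(x)|^2\,dx .$$ 2. If $d>4m+2$, then $|\psi|^2/\omega^{2m+1}$ is integrable on $Q_d$ and $$\widetilde C(m,d)\int_{Q_d}\frac{|\psi(x)|^2}{\omega(x)^{2m+1}}\,dx\le\int_{Q_d}|\nabla(\Delta^m\psi)(x)|^2\,dx .$$ Moreover, for each fixed $m$, $C(m,d)\asymp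 d^{2m}$ and $\widetilde C(m,d)\asymp d^{2m+1}$ as $d\to\infty$: there are constants $c_1,c_2>0$ and $N$, depending only on $m$, such that $c_1d^{2m}\le C(m,d)\le c_2d^{2m}$ for all $d\ge N$, and likewise for $\widetilde C(m,d)$ with $d^{2m+1}$. -/

import Mathlib

namespace TorusHardy

noncomputable section

open MeasureTheory

/-- `ℝ^d` with its Euclidean structure. -/
abbrev Space (d : ℕ) : Type := EuclideanSpace ℝ (Fin d)

/-- The open cube `Q_d = (-π, π)^d`. -/
def cube (d : ℕ) : Set (Space d) :=
  {x | ∀ i, x i ∈ Set.Ioo (-Real.pi) Real.pi}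

/-- The closed cube `[-π, π]^d`, the closure of `Q_d`. -/
def closedCube (d : ℕ) : Set (Space d) :=
  {x | ∀ i, x i ∈ Set.Icc (-Real.pi) Real.pi}

/-- The weight `ω(x) = ∑ⱼ sin²(xⱼ / 2)`. -/
def weight {d : ℕ} (x : Space d) : ℝ :=
  ∑ j, Real.sin (x j / 2) ^ 2

/-- A map is `2π`-periodic in each variable on the closed cube: it takes the same value at any two
opposite points of the faces `xᵢ = -π` and `xᵢ = π`. -/
def PeriodicOnFaces {d : ℕ} {F : Type*} (f : Space d → F) : Prop :=
  ∀ (i : Fin d), ∀ x ∈ closedCube d, x i = -Real.pi →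
    f x = f (x + EuclideanSpace.single i (2 * Real.pi))

/-- The functions the inequalities are about: `ψ` is smooth up to the boundary of `Q_d` (such a
function is given as the restriction of a smooth function on `ℝ^d`, whose values away from the
closed cube play no role), `ψ` and all its derivatives are `2π`-periodic in each variable, and `ψ`
has zero average over `Q_d`. -/
structure IsAdmissible {d : ℕ} (ψ : Space d → ℂ) : Prop where
  smooth : ContDiff ℝ (⊤ : ℕ∞) ψ
  periodic : ∀ n : ℕ, PeriodicOnFaces (iteratedFDeriv ℝ n ψ)
  zero_average : ∫ x in cube d, ψ x = 0

/-- `|∇f(x)|² = ∑ᵢ |∂ᵢ f(x)|²` for a complex-valued function `f`. -/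
def gradNormSq {d : ℕ} (f : Space d → ℂ) (x : Space d) : ℝ :=
  ∑ i, ‖fderiv ℝ f x (EuclideanSpace.single i 1)‖ ^ 2

/-- The `m`-th power `Δ^m ψ` of the Laplacian. -/
def lapPow {d : ℕ} (m : ℕ) (ψ : Space d → ℂ) : Space d → ℂ :=
  Laplacian.laplacian^[m] ψ

/-! ### The constants

In all of them `k` is a non-positive integer, so that `(-k).toNat` is `-k`. -/

/-- The constant `16 / (d + 2k - 2)²`. -/
def hardyC₁ (k : ℤ) (d : ℕ) : ℝ := 16 / ((d : ℝ) + 2 * k - 2) ^ 2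

/-- The constant `(3d + 2k - 2) / (d (d + 2k - 2))`. -/
def hardyC₂ (k : ℤ) (d : ℕ) : ℝ :=
  (3 * (d : ℝ) + 2 * k - 2) / ((d : ℝ) * ((d : ℝ) + 2 * k - 2))

/-- The constant `H(k, d)` of the weighted Hardy inequality. -/
def hardyConst (k : ℤ) (d : ℕ) : ℝ :=
  (∑ j ∈ Finset.range ((-k).toNat + 1),
      (d : ℝ) ^ j * hardyC₁ (k + j) d * ∏ i ∈ Finset.range j, hardyC₂ (k + i) d
    + (d : ℝ) ^ (-k) * ∏ i ∈ Finset.range ((-k).toNat + 1), hardyC₂ (k + i) d)⁻¹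

/-- The constant `16 / (d - 2k)²`. -/
def hardyRellichC₁ (k : ℤ) (d : ℕ) : ℝ := 16 / ((d : ℝ) - 2 * k) ^ 2

/-- The constant `(3d - 2k + 4) / (d (d - 2k))`. -/
def hardyRellichC₂ (k : ℤ) (d : ℕ) : ℝ :=
  (3 * (d : ℝ) - 2 * k + 4) / ((d : ℝ) * ((d : ℝ) - 2 * k))

/-- The constant `HR(k, d)` of the weighted Hardy-Rellich inequality. -/
def hardyRellichConst (k : ℤ) (d : ℕ) : ℝ :=
  (∑ j ∈ Finset.range ((-k).toNat + 1),
      (d : ℝ) ^ j * hardyRellichC₁ (k + j) d * ∏ i ∈ Finset.range j, hardyRellichC₂ (k + i) d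
    + (d : ℝ) ^ (-k) * ∏ i ∈ Finset.range ((-k).toNat + 1), hardyRellichC₂ (k + i) d)⁻¹

/-- The parameter `β(α, d) = (-4 + 8α + √2 √(d² - 4d + 16α² - 16α + 8)) / 8`. -/
def rellichBeta (α : ℝ) (d : ℕ) : ℝ :=
  1 / 8 * (-4 + 8 * α
    + Real.sqrt 2 * Real.sqrt ((d : ℝ) ^ 2 - 4 * d + 16 * α ^ 2 - 16 * α + 8))

/-- The constant `2β (d - 2β + 2α - 1) / d`. -/
def rellichC₁ (α : ℝ) (d : ℕ) : ℝ :=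
  2 * rellichBeta α d * ((d : ℝ) - 2 * rellichBeta α d + 2 * α - 1) / d

/-- The constant `β (d + 4β - 4α) (d + 2α - 2) (2β - 2α + 1) / (2d)`. -/
def rellichC₂ (α : ℝ) (d : ℕ) : ℝ :=
  rellichBeta α d * ((d : ℝ) + 4 * rellichBeta α d - 4 * α) * ((d : ℝ) + 2 * α - 2)
    * (2 * rellichBeta α d - 2 * α + 1) / (2 * d)

/-- The constant `R(k, d)` of the weighted Rellich inequality. -/
def rellichConst (k : ℤ) (d : ℕ) : ℝ :=
  ((d : ℝ) - 2 * k) ^ 2 * ((d : ℝ) + 2 * k - 4) ^ 2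
    / (256 * (1 + (hardyRellichConst k d)⁻¹
        * ((d : ℝ) * rellichC₁ ((k : ℝ) / 2) d
          + (d : ℝ) * rellichC₂ ((k : ℝ) / 2) d * (hardyConst k d)⁻¹)))

/-- `C(m, d) = ∏_{i < m} R(-2i, d)`. -/
def evenConst (m d : ℕ) : ℝ :=
  ∏ i ∈ Finset.range m, rellichConst (-2 * (i : ℤ)) d

/-- `C̃(m, d) = H(0, d) ∏_{i < m} R(-2i - 1, d)`. -/
def oddConst (m d : ℕ) : ℝ :=
  hardyConst 0 d * ∏ i ∈ Finset.range m, rellichConst (-2 * (i : ℤ) - 1) d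

end

end TorusHardy

/-! Everything rests on the divergence theorem for periodic fields and on two facts about the
weight: `Δω = d/2 - ω` and, by Cauchy–Schwarz, `|∇ω|² ≤ ω - ω²/d`. With `q = 1/(ω + ε)`, the
divergence of `a Re(ψ̄∇ψ) q^N + c |ψ|² ∇ω q^M` integrates to zero, so integral inequalities follow
from pointwise ones, which are sums of squares. Completing `|∇ψ + γqψ∇ω|²` gives `hardy_local`;
adding `|Δψ + σqψ|²` gives `rellich_local`. Then `ε → 0` by dominated convergence, the singular
weights being integrable (`integrableOn_inv_weight_pow`).

Unlike on `ℝ^d`, a lower order term remains on the torus. In the Hardy case it is a multiple of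
`∫|ψ|²`, absorbed by the Poincaré inequality (`poincare`, from Parseval), and this is where the zero
average enters. In the Rellich case it is a multiple of `∫|ψ|²/ω^(n+1)`, which `weightedSq_succ_le`
bounds by `∫|Δψ|²/ω^n`, by induction on `n` using the local Rellich inequality at the previous level
and `ω ≤ d`.

With `k = -n`, the sums defining `1/H` and `1/HR` satisfy first order recursions, and `const_step`
shows that they dominate the constants produced by that induction. The numerator of `R(-n, d)` over
256 is exactly the square of the leading constant `rellichLead`, and its remaining denominator
exceeds what the argument needs, because `C₂` is at least the lower order coefficient `2 *
rellichLead * rellichRest` (`two_mul_lead_mul_rest_le`) and `C₁ ≥ 0`. This gives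
`rellich_inequality`; iterating it on `ψ, Δψ, …`, and ending with Hardy in the odd case, proves both
inequalities. For the growth rates, each `R(-n, d)/d²` and `H(0, d)/d` has a positive limit. -/

namespace TorusHardy

open MeasureTheory Set Filter Topology

/-! ### Integration by parts on the cube -/

/-- The `i`-th vector of the standard basis of `ℝ^d`. -/
noncomputable abbrev basisVec {d : ℕ} (i : Fin d) : Space d := EuclideanSpace.single i 1

/-- The values of a family of functions agree on the pairs of opposite faces orthogonal to the
corresponding direction. -/
def NormalPeriodic {d : ℕ} {F : Type*} (f : Fin d → Space d → F) : Prop :=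
  ∀ (i : Fin d), ∀ x ∈ closedCube d, x i = -Real.pi →
    f i x = f i (x + EuclideanSpace.single i (2 * Real.pi))

lemma isOpen_cube (d : ℕ) : IsOpen (cube d) := by
  have : cube d = ⋂ i, (fun x : Space d => x i) ⁻¹' Ioo (-Real.pi) Real.pi := by
    ext x; simp [cube]
  rw [this]
  exact isOpen_iInter_of_finite fun i => isOpen_Ioo.preimage (by fun_prop)

lemma measurableSet_cube (d : ℕ) : MeasurableSet (cube d) := (isOpen_cube d).measurableSet

lemma cube_subset_closedCube (d : ℕ) : cube d ⊆ closedCube d :=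
  fun _ hx i => Ioo_subset_Icc_self (hx i)

lemma isCompact_closedCube (d : ℕ) : IsCompact (closedCube d) := by
  have h : closedCube d = WithLp.toLp 2 '' (Icc (fun _ => -Real.pi) (fun _ => Real.pi)) := by
    ext x
    constructor
    · intro hx
      exact ⟨WithLp.ofLp x, ⟨fun i => (hx i).1, fun i => (hx i).2⟩, rfl⟩
    · rintro ⟨y, hy, rfl⟩ i
      exact ⟨hy.1 i, hy.2 i⟩
  rw [h]
  exact isCompact_Icc.image (PiLp.continuous_toLp 2 _)

lemma _root_.Continuous.integrableOn_cube {d : ℕ} {E : Type*} [NormedAddCommGroup E]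
    {f : Space d → E} (hf : Continuous f) : IntegrableOn f (cube d) :=
  (hf.continuousOn.integrableOn_compact (isCompact_closedCube d)).mono_set
    (cube_subset_closedCube d)

/-- Passes to a closed box in `Fin d → ℝ`, the setting of the divergence theorem; the added faces
are null. -/
lemma setIntegral_cube_eq {d : ℕ} {E : Type*} [NormedAddCommGroup E] [NormedSpace ℝ E]
    (f : Space d → E) :
    ∫ x in cube d, f x
      = ∫ y in Icc (fun _ : Fin d => -Real.pi) (fun _ => Real.pi), f (WithLp.toLp 2 y) := by
  have h := (PiLp.volume_preserving_toLp (Fin d)).setIntegral_preimage_emb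
    (MeasurableEquiv.toLp 2 (Fin d → ℝ)).measurableEmbedding f (cube d)
  rw [← h]
  have hs : (WithLp.toLp 2 : (Fin d → ℝ) → Space d) ⁻¹' cube d
      = Set.pi univ fun _ => Ioo (-Real.pi) Real.pi := by
    ext y; simp [cube]
  rw [hs]
  exact setIntegral_congr_set Measure.univ_pi_Ioo_ae_eq_Icc

/-- The flux through a face involves only the component normal to it, so opposite faces cancel as
soon as the `i`-th component is periodic in the `i`-th direction. -/
lemma integral_divergence_eq_zero {d : ℕ} {E : Type*} [NormedAddCommGroup E] [NormedSpace ℝ E]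
    [CompleteSpace E] {f : Fin d → Space d → E} (hf : ∀ i, ContDiff ℝ 1 (f i))
    (hper : NormalPeriodic f) :
    ∫ x in cube d, ∑ i, fderiv ℝ (f i) x (basisVec i) = 0 := by
  rw [setIntegral_cube_eq]
  rcases d with _ | n
  · simp
  let T : (Fin (n + 1) → ℝ) →L[ℝ] Space (n + 1) :=
    (PiLp.continuousLinearEquiv 2 ℝ (fun _ : Fin (n + 1) => ℝ)).symm.toContinuousLinearMap
  have hT : ∀ y, T y = WithLp.toLp 2 y := fun _ => rfl
  have hTs : ∀ i, T (Pi.single i 1) = basisVec i := fun i => rfl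
  have hcont : ∀ i, Continuous fun y => fderiv ℝ (f i) (WithLp.toLp 2 y) (basisVec i) := fun i =>
    (((hf i).continuous_fderiv one_ne_zero).comp (PiLp.continuous_toLp 2 _)).clm_apply
      continuous_const
  have key := integral_divergence_of_hasFDerivAt_off_countable'
    (a := fun _ : Fin (n + 1) => -Real.pi) (b := fun _ => Real.pi)
    (fun _ => by linarith [Real.pi_pos]) (fun i y => f i (T y))
    (fun i y => (fderiv ℝ (f i) (T y)).comp T) ∅ countable_empty
    (fun i => ((hf i).continuous.comp T.continuous).continuousOn)
    (fun y _ i => (((hf i).differentiable one_ne_zero) (T y)).hasFDerivAt.comp y T.hasFDerivAt)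
    (by
      refine Continuous.integrableOn_Icc ?_
      exact continuous_finsetSum _ fun i _ => hcont i)
  -- Each summand is the difference of the integrals over two opposite faces.
  refine key.trans (Finset.sum_eq_zero fun i _ => sub_eq_zero.2 ?_)
  refine setIntegral_congr_fun measurableSet_Icc fun y hy => ?_
  have hmem : T (i.insertNth (-Real.pi) y) ∈ closedCube (n + 1) := by
    intro j
    rw [hT]
    rcases Fin.eq_self_or_eq_succAbove i j with rfl | ⟨k, rfl⟩
    · simp [Real.pi_pos.le]
    · simpa using ⟨hy.1 k, hy.2 k⟩
  have h := hper i _ hmem (by simp [hT])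
  beta_reduce
  rw [h]
  congr 1
  ext j
  rcases Fin.eq_self_or_eq_succAbove i j with rfl | ⟨k, rfl⟩
  · simp [hT]; ring
  · simp [hT, Fin.succAbove_ne]

end TorusHardy

namespace TorusHardy

open MeasureTheory Set Filter Topology

/-! ### Smooth periodic functions -/

/-- Smooth functions all of whose derivatives are periodic on the closed cube. -/
structure SmoothPeriodic {d : ℕ} {F : Type*} [NormedAddCommGroup F] [NormedSpace ℝ F]
    (f : Space d → F) : Prop where
  smooth : ContDiff ℝ (⊤ : ℕ∞) f
  periodic : ∀ n : ℕ, PeriodicOnFaces (iteratedFDeriv ℝ n f)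

/-- The partial derivative in the `i`-th direction. -/
noncomputable def pderiv {d : ℕ} {F : Type*} [NormedAddCommGroup F] [NormedSpace ℝ F]
    (i : Fin d) (f : Space d → F) (x : Space d) : F :=
  fderiv ℝ f x (basisVec i)

namespace SmoothPeriodic

variable {d : ℕ} {F G : Type*} [NormedAddCommGroup F] [NormedSpace ℝ F]
  [NormedAddCommGroup G] [NormedSpace ℝ G] {f g : Space d → F}

lemma apply_eq (hf : SmoothPeriodic f) : PeriodicOnFaces f := by
  intro i x hx hxi
  have h := congrArg (fun m => m 0) (hf.periodic 0 i x hx hxi)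
  simpa using h

protected lemma fderiv (hf : SmoothPeriodic f) : SmoothPeriodic (fderiv ℝ f) where
  smooth := hf.smooth.fderiv_right (by simp)
  periodic n i x hx hxi := by
    have h := hf.periodic (n + 1) i x hx hxi
    simp only [iteratedFDeriv_succ_eq_comp_right, Function.comp_apply] at h
    exact (LinearIsometryEquiv.injective _) h

lemma clm_comp (hf : SmoothPeriodic f) (L : F →L[ℝ] G) : SmoothPeriodic (fun x => L (f x)) where
  smooth := L.contDiff.comp hf.smooth
  periodic n i x hx hxi := by
    have h := fun y => L.iteratedFDeriv_comp_left (x := y) hf.smooth.contDiffAt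
      (i := n) (by exact_mod_cast le_top)
    change iteratedFDeriv ℝ n (L ∘ f) _ = iteratedFDeriv ℝ n (L ∘ f) _
    rw [h, h, hf.periodic n i x hx hxi]

protected lemma pderiv (hf : SmoothPeriodic f) (i : Fin d) : SmoothPeriodic (pderiv i f) :=
  hf.fderiv.clm_comp (ContinuousLinearMap.apply ℝ F (basisVec i))

lemma const (c : F) : SmoothPeriodic (fun _ : Space d => c) where
  smooth := contDiff_const
  periodic n i x _ _ := by
    rcases n with _ | n
    · ext; simp
    · simp [iteratedFDeriv_const_of_ne]

lemma add (hf : SmoothPeriodic f) (hg : SmoothPeriodic g) :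
    SmoothPeriodic (fun x => f x + g x) where
  smooth := hf.smooth.add hg.smooth
  periodic n i x hx hxi := by
    have h := fun y => iteratedFDeriv_add_apply (𝕜 := ℝ) (i := n) (x := y) (f := f) (g := g)
      (hf.smooth.of_le (by exact_mod_cast le_top)).contDiffAt
      (hg.smooth.of_le (by exact_mod_cast le_top)).contDiffAt
    change iteratedFDeriv ℝ n (f + g) _ = iteratedFDeriv ℝ n (f + g) _
    rw [h, h, hf.periodic n i x hx hxi, hg.periodic n i x hx hxi]

lemma sum {ι : Type*} (s : Finset ι) {f : ι → Space d → F} (hf : ∀ j ∈ s, SmoothPeriodic (f j)) :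
    SmoothPeriodic (fun x => ∑ j ∈ s, f j x) := by
  classical
  induction s using Finset.induction_on with
  | empty => simpa using const 0
  | insert a s ha ih =>
    simp only [Finset.sum_insert ha]
    exact (hf a (by simp)).add (ih fun j hj => hf j (by simp [hj]))

end SmoothPeriodic

/-! ### The Laplacian of smooth periodic functions. -/

variable {d : ℕ} {ψ : Space d → ℂ}

lemma laplacian_eq_sum_pderiv (hψ : ContDiff ℝ (⊤ : ℕ∞) ψ) (x : Space d) :
    Laplacian.laplacian ψ x = ∑ i, pderiv i (pderiv i ψ) x := by
  rw [congrFun (InnerProductSpace.laplacian_eq_iteratedFDeriv_orthonormalBasis ψ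
    (EuclideanSpace.basisFun (Fin d) ℝ)) x]
  refine Finset.sum_congr rfl fun i _ => ?_
  rw [iteratedFDeriv_two_apply]
  have hd : DifferentiableAt ℝ (fderiv ℝ ψ) x :=
    ((hψ.fderiv_right (m := (⊤ : ℕ∞)) (by simp)).differentiable (by simp)) x
  have h : pderiv i (pderiv i ψ) x = fderiv ℝ (fderiv ℝ ψ) x (basisVec i) (basisVec i) := by
    unfold pderiv
    rw [fderiv_clm_apply hd (by fun_prop)]
    simp
  rw [h]
  simp

lemma SmoothPeriodic.laplacian (hψ : SmoothPeriodic ψ) :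
    SmoothPeriodic (Laplacian.laplacian ψ) := by
  rw [funext (laplacian_eq_sum_pderiv hψ.smooth)]
  exact SmoothPeriodic.sum _ fun i _ => (hψ.pderiv i).pderiv i

lemma SmoothPeriodic.normalPeriodic {F : Type*} [NormedAddCommGroup F] [NormedSpace ℝ F]
    {f : Fin d → Space d → F} (hf : ∀ i, SmoothPeriodic (f i)) : NormalPeriodic f :=
  fun i x hx hxi => (hf i).apply_eq i x hx hxi

lemma SmoothPeriodic.integral_laplacian (hψ : SmoothPeriodic ψ) :
    ∫ x in cube d, Laplacian.laplacian ψ x = 0 := by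
  rw [funext (laplacian_eq_sum_pderiv hψ.smooth)]
  exact integral_divergence_eq_zero (f := fun i => pderiv i ψ)
    (fun i => (hψ.pderiv i).smooth.of_le (by exact_mod_cast le_top))
    (SmoothPeriodic.normalPeriodic fun i => hψ.pderiv i)

lemma IsAdmissible.smoothPeriodic (hψ : IsAdmissible ψ) : SmoothPeriodic ψ :=
  ⟨hψ.smooth, hψ.periodic⟩

/-- The zero average comes from the divergence theorem, whatever the average of `ψ`. This allows
induction on the power of the Laplacian. -/
lemma IsAdmissible.laplacian (hψ : IsAdmissible ψ) : IsAdmissible (Laplacian.laplacian ψ) where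
  smooth := hψ.smoothPeriodic.laplacian.smooth
  periodic := hψ.smoothPeriodic.laplacian.periodic
  zero_average := hψ.smoothPeriodic.integral_laplacian

lemma gradNormSq_eq_sum_pderiv (f : Space d → ℂ) (x : Space d) :
    gradNormSq f x = ∑ i, ‖pderiv i f x‖ ^ 2 := rfl

/-! ### The weight -/

lemma weight_nonneg (x : Space d) : 0 ≤ weight x :=
  Finset.sum_nonneg fun _ _ => sq_nonneg _

lemma weight_le (x : Space d) : weight x ≤ d := by
  refine (Finset.sum_le_sum fun j _ => Real.sin_sq_le_one (x j / 2)).trans ?_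
  simp

lemma contDiff_weight {n : WithTop ℕ∞} : ContDiff ℝ n (weight : Space d → ℝ) := by
  unfold weight
  refine ContDiff.sum fun j _ => ContDiff.pow (Real.contDiff_sin.comp ?_) 2
  exact ((EuclideanSpace.proj (𝕜 := ℝ) j).contDiff).div_const 2

lemma weight_pos {x : Space d} (hx : x ∈ cube d) (h0 : x ≠ 0) : 0 < weight x := by
  obtain ⟨j, hj⟩ : ∃ j, x j ≠ 0 := by
    by_contra! h
    exact h0 (by ext j; simpa using h j)
  refine Finset.sum_pos' (fun _ _ => sq_nonneg _) ⟨j, Finset.mem_univ _, ?_⟩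
  have h1 := hx j
  refine sq_pos_of_ne_zero fun h => hj ?_
  have h2 := (Real.sin_eq_zero_iff_of_lt_of_lt (by linarith [h1.1, Real.pi_pos])
    (by linarith [h1.2, Real.pi_pos])).1 h
  linarith

lemma periodicOnFaces_weight : PeriodicOnFaces (weight : Space d → ℝ) := by
  intro i x _ _
  refine Finset.sum_congr rfl fun j _ => ?_
  by_cases h : j = i
  · subst h
    have : (x + EuclideanSpace.single j (2 * Real.pi)) j / 2 = x j / 2 + Real.pi := by
      simp; ring
    rw [this, Real.sin_add_pi, neg_sq]
  · simp [h]

/-- With `s_j = sin²(x_j/2)` one has `(∂_j ω)² = s_j - s_j²`, and Cauchy–Schwarz gives `(∑ s_j)² ≤ d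
∑ s_j²`. -/
lemma gradWeight_sq_sum_le (x : Space d) :
    ∑ j, (Real.sin (x j) / 2) ^ 2 ≤ weight x - weight x ^ 2 / d := by
  have h1 : ∀ j, (Real.sin (x j) / 2) ^ 2
      = Real.sin (x j / 2) ^ 2 - (Real.sin (x j / 2) ^ 2) ^ 2 := fun j => by
    have h2 : Real.sin (x j) = 2 * Real.sin (x j / 2) * Real.cos (x j / 2) := by
      rw [← Real.sin_two_mul]; ring_nf
    rw [h2, div_pow, mul_pow, mul_pow, Real.cos_sq']
    ring
  simp only [h1, Finset.sum_sub_distrib]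
  have h3 : weight x ^ 2 ≤ d * ∑ j, (Real.sin (x j / 2) ^ 2) ^ 2 := by
    have := sq_sum_le_card_mul_sum_sq (s := Finset.univ) (f := fun j => Real.sin (x j / 2) ^ 2)
    simpa [weight] using this
  rcases Nat.eq_zero_or_pos d with rfl | hd
  · simp [weight]
  · have hd' : (0 : ℝ) < d := by exact_mod_cast hd
    have : weight x ^ 2 / d ≤ ∑ j, (Real.sin (x j / 2) ^ 2) ^ 2 := by
      rw [div_le_iff₀ hd']; linarith
    simp only [weight] at this ⊢
    linarith

/-- The left side is `Δω`. -/
lemma sum_cos_half (x : Space d) : ∑ j, Real.cos (x j) / 2 = d / 2 - weight x := by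
  have h1 : ∀ j, Real.cos (x j) / 2 = 1 / 2 - Real.sin (x j / 2) ^ 2 := fun j => by
    have h2 : Real.cos (x j) = 1 - 2 * Real.sin (x j / 2) ^ 2 := by
      rw [← Real.cos_two_mul_eq_one_sub]; ring_nf
    rw [h2]; ring
  simp only [h1, Finset.sum_sub_distrib, weight]
  simp [div_eq_mul_inv]

end TorusHardy

namespace TorusHardy

open MeasureTheory Set Filter Topology

/-! ### The fundamental divergence identity -/

variable {d : ℕ}

lemma hasDerivAt_line {F : Type*} [NormedAddCommGroup F] [NormedSpace ℝ F] {f : Space d → F}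
    {x : Space d} (hf : DifferentiableAt ℝ f x) (j : Fin d) :
    HasDerivAt (fun t : ℝ => f (x + t • basisVec j)) (pderiv j f x) 0 :=
  hf.hasFDerivAt.hasLineDerivAt (basisVec j)

lemma hasDerivAt_coord_line (x : Space d) (j : Fin d) :
    HasDerivAt (fun t : ℝ => (x + t • basisVec j) j) 1 0 := by
  simpa using (hasDerivAt_id (0 : ℝ)).const_add (x j)

lemma hasDerivAt_sin_line (x : Space d) (j : Fin d) :
    HasDerivAt (fun t : ℝ => Real.sin ((x + t • basisVec j) j) / 2) (Real.cos (x j) / 2) 0 := by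
  simpa using ((hasDerivAt_coord_line x j).sin).div_const 2

lemma hasDerivAt_weight_line (x : Space d) (j : Fin d) :
    HasDerivAt (fun t : ℝ => weight (x + t • basisVec j)) (Real.sin (x j) / 2) 0 := by
  have h : ∀ i : Fin d, HasDerivAt
      (fun t : ℝ => Real.sin ((x + t • basisVec j) i / 2) ^ 2)
      (if i = j then Real.sin (x j) / 2 else 0) 0 := by
    intro i
    split_ifs with hij
    · subst hij
      have := (((hasDerivAt_coord_line x i).div_const 2).sin).pow 2
      refine this.congr_deriv ?_
      have h2 : Real.sin (x i) = 2 * Real.sin (x i / 2) * Real.cos (x i / 2) := by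
        rw [← Real.sin_two_mul]; ring_nf
      rw [h2]
      simp
      ring
    · have : (fun t : ℝ => Real.sin ((x + t • basisVec j) i / 2) ^ 2)
          = fun _ => Real.sin (x i / 2) ^ 2 := by
        ext t; simp [hij]
      rw [this]
      exact hasDerivAt_const _ _
  have := HasDerivAt.fun_sum (u := Finset.univ) fun i _ => h i
  simpa [weight] using this

/-- The regularised reciprocal weight `1 / (ω + ε)`. -/
noncomputable def regWeight (ε : ℝ) (x : Space d) : ℝ := (weight x + ε)⁻¹

lemma regWeight_pos {ε : ℝ} (hε : 0 < ε) (x : Space d) : 0 < regWeight ε x :=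
  inv_pos.2 (by linarith [weight_nonneg x])

lemma contDiff_regWeight {ε : ℝ} (hε : 0 < ε) {n : WithTop ℕ∞} :
    ContDiff ℝ n (regWeight ε : Space d → ℝ) :=
  (contDiff_weight.add contDiff_const).inv fun x => by linarith [weight_nonneg x]

lemma hasDerivAt_regWeight_pow_line {ε : ℝ} (hε : 0 < ε) (x : Space d) (j : Fin d) (n : ℕ) :
    HasDerivAt (fun t : ℝ => regWeight ε (x + t • basisVec j) ^ n)
      (-(n * (Real.sin (x j) / 2) * regWeight ε x ^ (n + 1))) 0 := by
  have h0 : weight (x + (0 : ℝ) • basisVec j) + ε ≠ 0 := by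
    linarith [weight_nonneg (x + (0 : ℝ) • basisVec j)]
  have h := (((hasDerivAt_weight_line x j).add_const ε).inv h0).pow n
  refine h.congr_deriv ?_
  rcases n with _ | n
  · simp
  · simp only [zero_smul, add_zero, regWeight, Nat.add_sub_cancel, Pi.inv_apply]
    rw [pow_succ _ (n + 1), pow_succ _ n]
    field_simp

lemma periodicOnFaces_regWeight (ε : ℝ) : PeriodicOnFaces (regWeight ε : Space d → ℝ) :=
  fun i x hx hxi => by simp only [regWeight, ← periodicOnFaces_weight i x hx hxi]

variable {ψ : Space d → ℂ}

/-- The radial part `Re (ψ̄ ∇ψ · ∇ω)` of `∇|ψ|² / 2`. -/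
noncomputable def radialTerm (ψ : Space d → ℂ) (x : Space d) : ℝ :=
  ∑ j, inner ℝ (ψ x) (pderiv j ψ x) * (Real.sin (x j) / 2)

/-- `|∇ω|²`. -/
noncomputable def gradWeightSq (x : Space d) : ℝ := ∑ j, (Real.sin (x j) / 2) ^ 2

/-- The field `a Re (ψ̄ ∇ψ) q^N + c |ψ|² ∇ω q^M`, where `q = 1 / (ω + ε)`. -/
noncomputable def hardyField (a c ε : ℝ) (N M : ℕ) (ψ : Space d → ℂ) (j : Fin d) (x : Space d) :
    ℝ :=
  a * (inner ℝ (ψ x) (pderiv j ψ x) * regWeight ε x ^ N)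
    + c * (‖ψ x‖ ^ 2 * (Real.sin (x j) / 2) * regWeight ε x ^ M)

/-- The divergence of `hardyField`. -/
noncomputable def hardyDiv (a c ε : ℝ) (N M : ℕ) (ψ : Space d → ℂ) (x : Space d) : ℝ :=
  a * ((inner ℝ (ψ x) (Laplacian.laplacian ψ x) + gradNormSq ψ x) * regWeight ε x ^ N
      - N * radialTerm ψ x * regWeight ε x ^ (N + 1))
    + c * (2 * radialTerm ψ x * regWeight ε x ^ M
      + ‖ψ x‖ ^ 2 * ((d / 2 - weight x) * regWeight ε x ^ M
        - M * gradWeightSq x * regWeight ε x ^ (M + 1)))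

lemma contDiff_hardyField (hψ : ContDiff ℝ (⊤ : ℕ∞) ψ) (a c : ℝ) {ε : ℝ} (hε : 0 < ε) (N M : ℕ)
    (j : Fin d) : ContDiff ℝ 1 (hardyField a c ε N M ψ j) := by
  have h1 : ContDiff ℝ 1 ψ := hψ.of_le (by exact_mod_cast le_top)
  have h2 : ContDiff ℝ 1 (pderiv j ψ) :=
    ((hψ.fderiv_right (m := (⊤ : ℕ∞)) (by simp)).clm_apply contDiff_const).of_le
      (by exact_mod_cast le_top)
  have h3 : ContDiff ℝ 1 (fun x : Space d => Real.sin (x j) / 2) :=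
    (Real.contDiff_sin.comp (EuclideanSpace.proj (𝕜 := ℝ) j).contDiff).div_const 2
  unfold hardyField
  exact (contDiff_const.mul ((h1.inner ℝ h2).mul ((contDiff_regWeight hε).pow N))).add
    (contDiff_const.mul (((h1.norm_sq ℝ).mul h3).mul ((contDiff_regWeight hε).pow M)))

lemma sum_pderiv_hardyField (hψ : ContDiff ℝ (⊤ : ℕ∞) ψ) (a c : ℝ) {ε : ℝ} (hε : 0 < ε)
    (N M : ℕ) (x : Space d) :
    ∑ j, fderiv ℝ (hardyField a c ε N M ψ j) x (basisVec j) = hardyDiv a c ε N M ψ x := by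
  have h1 : Differentiable ℝ ψ := hψ.differentiable (by simp)
  have h2 : ∀ j, Differentiable ℝ (pderiv j ψ) := fun j =>
    ((hψ.fderiv_right (m := (⊤ : ℕ∞)) (by simp)).clm_apply contDiff_const).differentiable
      (by simp)
  have key : ∀ j, fderiv ℝ (hardyField a c ε N M ψ j) x (basisVec j)
      = a * ((inner ℝ (ψ x) (pderiv j (pderiv j ψ) x) + ‖pderiv j ψ x‖ ^ 2) * regWeight ε x ^ N
          - N * (inner ℝ (ψ x) (pderiv j ψ x) * (Real.sin (x j) / 2)) * regWeight ε x ^ (N + 1))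
        + c * (2 * (inner ℝ (ψ x) (pderiv j ψ x) * (Real.sin (x j) / 2)) * regWeight ε x ^ M
          + ‖ψ x‖ ^ 2 * (Real.cos (x j) / 2 * regWeight ε x ^ M
            - M * (Real.sin (x j) / 2) ^ 2 * regWeight ε x ^ (M + 1))) := by
    intro j
    -- The partial derivative is computed as a one-variable derivative along `x + t e_j` and
    -- identified by uniqueness.
    have hl := hasDerivAt_line
      ((contDiff_hardyField hψ a c hε N M j).differentiable one_ne_zero x) j
    refine hl.unique ?_
    have e1 := (hasDerivAt_line (h1 x) j).inner ℝ (hasDerivAt_line (h2 j x) j)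
    have e2 := (hasDerivAt_line (h1 x) j).norm_sq
    have e3 := (e1.mul (hasDerivAt_regWeight_pow_line hε x j N)).const_mul a
    have e4 := ((e2.mul (hasDerivAt_sin_line x j)).mul
      (hasDerivAt_regWeight_pow_line hε x j M)).const_mul c
    refine (e3.add e4).congr_deriv ?_
    simp only [zero_smul, add_zero, real_inner_self_eq_norm_sq, Pi.mul_apply]
    ring
  simp only [key, hardyDiv, gradNormSq_eq_sum_pderiv, laplacian_eq_sum_pderiv hψ, radialTerm,
    gradWeightSq, ← sum_cos_half, inner_sum, Finset.sum_add_distrib, Finset.sum_sub_distrib,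
    Finset.sum_mul, Finset.mul_sum, mul_add, mul_sub, add_mul]

lemma normalPeriodic_hardyField (hψ : SmoothPeriodic ψ) (a c ε : ℝ) (N M : ℕ) :
    NormalPeriodic (hardyField a c ε N M ψ) := by
  intro i x hx hxi
  have h4 : (x + EuclideanSpace.single i (2 * Real.pi)) i = x i + 2 * Real.pi := by simp
  simp only [hardyField, ← hψ.apply_eq i x hx hxi, ← (hψ.pderiv i).apply_eq i x hx hxi,
    ← periodicOnFaces_regWeight ε i x hx hxi, h4, Real.sin_add_two_pi]

lemma integral_hardyDiv (hψ : SmoothPeriodic ψ) (a c : ℝ) {ε : ℝ} (hε : 0 < ε) (N M : ℕ) :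
    ∫ x in cube d, hardyDiv a c ε N M ψ x = 0 := by
  rw [← integral_divergence_eq_zero (fun j => contDiff_hardyField hψ.smooth a c hε N M j)
    (normalPeriodic_hardyField hψ a c ε N M)]
  simp only [sum_pderiv_hardyField hψ.smooth a c hε N M]

lemma continuous_hardyDiv (hψ : ContDiff ℝ (⊤ : ℕ∞) ψ) (a c : ℝ) {ε : ℝ} (hε : 0 < ε) (N M : ℕ) :
    Continuous (hardyDiv a c ε N M ψ) := by
  rw [← funext (sum_pderiv_hardyField hψ a c hε N M)]
  exact continuous_finsetSum _ fun j _ =>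
    ((contDiff_hardyField hψ a c hε N M j).continuous_fderiv one_ne_zero).clm_apply
      continuous_const

/-- If `A ≤ B + div V` pointwise for one of the fields `V` above, then `∫ A ≤ ∫ B`. -/
lemma integral_le_of_le_add_hardyDiv (hψ : SmoothPeriodic ψ) (a c : ℝ) {ε : ℝ} (hε : 0 < ε)
    (N M : ℕ) {A B : Space d → ℝ} (hA : Continuous A) (hB : Continuous B)
    (h : ∀ x, A x ≤ B x + hardyDiv a c ε N M ψ x) :
    ∫ x in cube d, A x ≤ ∫ x in cube d, B x := by
  have hV := (continuous_hardyDiv hψ.smooth a c hε N M).integrableOn_cube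
  calc ∫ x in cube d, A x ≤ ∫ x in cube d, (B x + hardyDiv a c ε N M ψ x) :=
        integral_mono hA.integrableOn_cube (hB.integrableOn_cube.add hV) h
    _ = ∫ x in cube d, B x := by
        rw [integral_add hB.integrableOn_cube hV, integral_hardyDiv hψ a c hε, add_zero]

lemma gradWeightSq_le (x : Space d) : gradWeightSq x ≤ weight x - weight x ^ 2 / d :=
  gradWeight_sq_sum_le x

lemma weight_mul_regWeight_le {ε : ℝ} (hε : 0 < ε) (x : Space d) :
    weight x * regWeight ε x ≤ 1 := by
  have h0 := weight_nonneg x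
  rw [regWeight, ← div_eq_mul_inv]
  exact div_le_one_of_le₀ (by linarith) (by linarith)

lemma gradWeightSq_mul_regWeight_le {ε : ℝ} (hε : 0 < ε) (x : Space d) :
    gradWeightSq x * regWeight ε x ≤ 1 - weight x / d := by
  have hq := regWeight_pos hε x
  have h1 := weight_mul_regWeight_le hε x
  have h2 : 0 ≤ 1 - weight x / d := by
    rcases Nat.eq_zero_or_pos d with rfl | hd
    -- In dimension zero the quotient by `d` is `0`, so the claim reads `0 ≤ 1`.
    · simp
    · have hd' : (0 : ℝ) < d := by exact_mod_cast hd
      have := (div_le_one hd').2 (weight_le x)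
      linarith
  calc gradWeightSq x * regWeight ε x
      ≤ (weight x - weight x ^ 2 / d) * regWeight ε x :=
        mul_le_mul_of_nonneg_right (gradWeightSq_le x) hq.le
    _ = weight x * regWeight ε x * (1 - weight x / d) := by ring
    _ ≤ 1 * (1 - weight x / d) := mul_le_mul_of_nonneg_right h1 h2
    _ = _ := one_mul _

/-- The right side is `∑_j |∂_jψ + γ q ψ ∂_jω|²` expanded. -/
lemma completed_square_nonneg (γ q : ℝ) (ψ : Space d → ℂ) (x : Space d) :
    0 ≤ gradNormSq ψ x + 2 * (γ * q) * radialTerm ψ x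
      + (γ * q) ^ 2 * (‖ψ x‖ ^ 2 * gradWeightSq x) := by
  have h : ∀ j, ‖pderiv j ψ x + (γ * q * (Real.sin (x j) / 2)) • ψ x‖ ^ 2
      = ‖pderiv j ψ x‖ ^ 2 + 2 * (γ * q) * (inner ℝ (ψ x) (pderiv j ψ x) * (Real.sin (x j) / 2))
        + (γ * q) ^ 2 * (‖ψ x‖ ^ 2 * (Real.sin (x j) / 2) ^ 2) := fun j => by
    rw [norm_add_sq_real, inner_smul_right, norm_smul, mul_pow, real_inner_comm, Real.norm_eq_abs,
      sq_abs]
    ring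
  have h2 := Finset.sum_nonneg fun j (_ : j ∈ Finset.univ) =>
    sq_nonneg ‖pderiv j ψ x + (γ * q * (Real.sin (x j) / 2)) • ψ x‖
  simp only [h, Finset.sum_add_distrib, ← Finset.mul_sum] at h2
  exact h2

end TorusHardy

namespace TorusHardy

open MeasureTheory Set Filter Topology

/-! ### Removing the regularisation -/

variable {d : ℕ}

lemma ae_weight_pos (hd : 0 < d) : ∀ᵐ x ∂(volume.restrict (cube d)), 0 < weight x := by
  obtain ⟨d, rfl⟩ : ∃ k, d = k + 1 := ⟨d - 1, by omega⟩
  have h0 : ∀ᵐ x ∂(volume.restrict (cube (d + 1))), x ≠ 0 :=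
    ae_restrict_of_ae (by simp [ae_iff])
  filter_upwards [h0, ae_restrict_mem (measurableSet_cube _)] with x h1 h2
  exact weight_pos h2 h1

lemma regWeight_le_inv {ε : ℝ} (hε : 0 < ε) {x : Space d} (hx : 0 < weight x) :
    regWeight ε x ≤ (weight x)⁻¹ :=
  inv_anti₀ hx (by linarith)

lemma tendsto_regWeight_pow {x : Space d} (hx : 0 < weight x) (n : ℕ) :
    Tendsto (fun k : ℕ => regWeight (1 / ((k : ℝ) + 1)) x ^ n) atTop (𝓝 ((weight x ^ n)⁻¹)) := by
  have h1 : Tendsto (fun k : ℕ => weight x + 1 / ((k : ℝ) + 1)) atTop (𝓝 (weight x + 0)) :=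
    tendsto_one_div_add_atTop_nhds_zero_nat.const_add _
  rw [add_zero] at h1
  rw [← inv_pow]
  exact (h1.inv₀ hx.ne').pow n

/-- The field is `q^(n+1) ∇ω`, obtained from `ψ = 1`; `ωq ≤ 1` and `|∇ω|² q ≤ 1` bound its
divergence below by `(d/2 - n - 1) q^(n+1) - q^n`. -/
lemma integral_regWeight_pow_succ_le (n : ℕ) {ε : ℝ} (hε : 0 < ε) :
    ((d : ℝ) / 2 - n - 1) * ∫ x in cube d, regWeight ε x ^ (n + 1)
      ≤ ∫ x in cube d, regWeight ε x ^ n := by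
  rw [← integral_const_mul]
  have hc : Continuous (regWeight ε : Space d → ℝ) := (contDiff_regWeight hε (n := 0)).continuous
  refine integral_le_of_le_add_hardyDiv (SmoothPeriodic.const (1 : ℂ)) 0 1 hε 0 (n + 1)
    (continuous_const.mul (hc.pow _)) (hc.pow _) fun x => ?_
  have hq := regWeight_pos hε x
  have h1 := weight_mul_regWeight_le hε x
  have h2 : gradWeightSq x * regWeight ε x ≤ 1 := by
    refine (mul_le_mul_of_nonneg_right ((gradWeightSq_le x).trans ?_) hq.le).trans h1
    have : 0 ≤ weight x ^ 2 / d := by positivity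
    linarith
  have h3 : radialTerm (fun _ => (1 : ℂ)) x = 0 := by simp [radialTerm, pderiv]
  simp only [hardyDiv, h3]
  simp only [norm_one]
  have h4 : gradWeightSq x * regWeight ε x * regWeight ε x ^ (n + 1)
      ≤ 1 * regWeight ε x ^ (n + 1) := mul_le_mul_of_nonneg_right h2 (by positivity)
  have h5 : weight x * regWeight ε x * regWeight ε x ^ n ≤ 1 * regWeight ε x ^ n :=
    mul_le_mul_of_nonneg_right h1 (by positivity)
  have h6 : ((n + 1 : ℕ) : ℝ) * (gradWeightSq x * regWeight ε x * regWeight ε x ^ (n + 1))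
      ≤ ((n + 1 : ℕ) : ℝ) * (1 * regWeight ε x ^ (n + 1)) :=
    mul_le_mul_of_nonneg_left h4 (by positivity)
  push_cast at h6 ⊢
  rw [pow_succ _ (n + 1)]
  rw [pow_succ] at h6 ⊢
  linarith

/-- By induction on `n`, the preceding estimate bounds the regularised integrals uniformly in `ε`,
and Fatou's lemma passes to the limit. -/
lemma integrableOn_inv_weight_pow (n : ℕ) (hn : 2 * n < d) :
    IntegrableOn (fun x : Space d => (weight x ^ n)⁻¹) (cube d) := by
  induction n with
  | zero => simpa using (continuous_const (y := (1 : ℝ))).integrableOn_cube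
  | succ n ih =>
    have ih := ih (by omega)
    set K := ∫ x in cube d, (weight x ^ n)⁻¹
    have hd : (2 : ℝ) * (n + 1) < d := by exact_mod_cast hn
    have hae := ae_weight_pos (d := d) (by omega)
    have hc : ∀ k : ℕ, Continuous (regWeight (1 / ((k : ℝ) + 1)) : Space d → ℝ) := fun k =>
      (contDiff_regWeight (by positivity) (n := 0)).continuous
    have hb : ∀ k : ℕ, ∫ x in cube d, regWeight (1 / ((k : ℝ) + 1)) x ^ (n + 1)
        ≤ K / ((d : ℝ) / 2 - n - 1) := fun k => by
      rw [le_div_iff₀' (by linarith)]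
      refine (integral_regWeight_pow_succ_le n (by positivity)).trans ?_
      refine integral_mono_ae ((hc k).pow n).integrableOn_cube ih ?_
      filter_upwards [hae] with x hx
      rw [← inv_pow]
      exact pow_le_pow_left₀ (regWeight_pos (by positivity) x).le
        (regWeight_le_inv (by positivity) hx) n
    have hmeas : Measurable (fun x : Space d => (weight x ^ (n + 1))⁻¹) :=
      ((contDiff_weight (n := 0)).continuous.measurable.pow_const _).inv
    refine ⟨hmeas.aestronglyMeasurable, ?_⟩
    rw [hasFiniteIntegral_iff_ofReal (Eventually.of_forall fun x =>
      inv_nonneg.2 (pow_nonneg (weight_nonneg x) _))]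
    have hF : ∫⁻ x in cube d, ENNReal.ofReal ((weight x ^ (n + 1))⁻¹)
        ≤ liminf (fun k : ℕ => ∫⁻ x in cube d,
          ENNReal.ofReal (regWeight (1 / ((k : ℝ) + 1)) x ^ (n + 1))) atTop := by
      refine le_trans (le_of_eq (lintegral_congr_ae ?_)) (lintegral_liminf_le fun k =>
        ((hc k).pow (n + 1)).measurable.ennreal_ofReal)
      filter_upwards [hae] with x hx
      exact ((ENNReal.continuous_ofReal.tendsto _).comp
        (tendsto_regWeight_pow hx (n + 1))).liminf_eq.symm
    refine hF.trans_lt (lt_of_le_of_lt (b := ENNReal.ofReal (K / ((d : ℝ) / 2 - n - 1))) ?_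
      ENNReal.ofReal_lt_top)
    -- A number eventually below the sequence is below one of its terms, so the uniform bound
    -- applies.
    refine liminf_le_of_le (by isBoundedDefault) fun b hb' => ?_
    obtain ⟨k, hk⟩ := hb'.exists
    refine hk.trans ?_
    have hi : IntegrableOn (fun x => regWeight (1 / ((k : ℝ) + 1)) x ^ (n + 1)) (cube d) :=
      ((hc k).pow (n + 1)).integrableOn_cube
    rw [← ofReal_integral_eq_lintegral_ofReal hi
      (Eventually.of_forall fun x => pow_nonneg (regWeight_pos (by positivity) x).le _)]
    exact ENNReal.ofReal_le_ofReal (hb k)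

lemma integrableOn_div_weight_pow {g : Space d → ℝ} (hg : Continuous g) (n : ℕ) (hn : 2 * n < d) :
    IntegrableOn (fun x => g x / weight x ^ n) (cube d) := by
  obtain ⟨C, hC⟩ := (isCompact_closedCube d).exists_bound_of_continuousOn hg.continuousOn
  refine Integrable.bdd_mul (c := C) (integrableOn_inv_weight_pow n hn)
    hg.aestronglyMeasurable ?_
  filter_upwards [ae_restrict_mem (measurableSet_cube d)] with x hx
  exact hC x (cube_subset_closedCube d hx)

lemma tendsto_integral_mul_regWeight_pow {g : Space d → ℝ} (hg : Continuous g) (n : ℕ)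
    (hn : 2 * n < d) :
    Tendsto (fun k : ℕ => ∫ x in cube d, g x * regWeight (1 / ((k : ℝ) + 1)) x ^ n) atTop
      (𝓝 (∫ x in cube d, g x / weight x ^ n)) := by
  have hae := ae_weight_pos (d := d) (by omega)
  refine tendsto_integral_of_dominated_convergence (fun x => |g x| / weight x ^ n)
    (fun k => ?_) (integrableOn_div_weight_pow hg.abs n hn) (fun k => ?_) ?_
  · exact (hg.mul ((contDiff_regWeight (by positivity) (n := 0)).continuous.pow
      n)).aestronglyMeasurable
  · filter_upwards [hae] with x hx
    have hq := regWeight_pos (ε := 1 / ((k : ℝ) + 1)) (by positivity) x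
    rw [Real.norm_eq_abs, abs_mul, abs_of_nonneg (pow_nonneg hq.le n), div_eq_mul_inv |g x|, ← inv_pow]
    exact mul_le_mul_of_nonneg_left
      (pow_le_pow_left₀ hq.le (regWeight_le_inv (by positivity) hx) n) (abs_nonneg _)
  · filter_upwards [hae] with x hx
    exact (tendsto_regWeight_pow hx n).const_mul _

end TorusHardy

namespace TorusHardy

open MeasureTheory Set Filter Topology

/-! ### The local inequalities -/

variable {d : ℕ} {ψ : Space d → ℂ}

/-- The weighted integral `∫ |f|² / ω^n` over the cube. -/
noncomputable def weightedSq (n : ℕ) (f : Space d → ℂ) : ℝ :=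
  ∫ x in cube d, ‖f x‖ ^ 2 / weight x ^ n

lemma weightedSq_nonneg (n : ℕ) (f : Space d → ℂ) : 0 ≤ weightedSq n f :=
  integral_nonneg fun x => div_nonneg (sq_nonneg _) (pow_nonneg (weight_nonneg x) _)

lemma SmoothPeriodic.continuous {F : Type*} [NormedAddCommGroup F] [NormedSpace ℝ F]
    {f : Space d → F} (hf : SmoothPeriodic f) : Continuous f := hf.smooth.continuous

lemma SmoothPeriodic.continuous_gradNormSq (hψ : SmoothPeriodic ψ) :
    Continuous (gradNormSq ψ) := by
  simp only [funext (gradNormSq_eq_sum_pderiv ψ)]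
  exact continuous_finsetSum _ fun i _ => ((hψ.pderiv i).continuous.norm).pow 2

lemma weightedSq_le_succ (hψ : Continuous ψ) (n : ℕ) (hn : 2 * (n + 1) < d) :
    weightedSq n ψ ≤ d * weightedSq (n + 1) ψ := by
  unfold weightedSq
  rw [← integral_const_mul]
  refine integral_mono_ae (integrableOn_div_weight_pow (hψ.norm.pow 2) n (by omega))
    ((integrableOn_div_weight_pow (hψ.norm.pow 2) (n + 1) hn).const_mul _) ?_
  filter_upwards [ae_weight_pos (d := d) (by omega)] with x hx
  rw [mul_div_assoc', div_le_div_iff₀ (by positivity) (by positivity), pow_succ (weight x) n]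
  have h := mul_le_mul_of_nonneg_left (weight_le x)
    (by positivity : 0 ≤ ‖ψ x‖ ^ 2 * weight x ^ n)
  linarith

/-- The Hardy inequality, with a lower order term. -/
lemma hardy_local (hψ : SmoothPeriodic ψ) (hd : 2 < d) {γ : ℝ} (hγ : γ = ((d : ℝ) - 2) / 4) :
    γ ^ 2 * weightedSq 1 ψ
      ≤ (∫ x in cube d, gradNormSq ψ x) + γ * (1 - (γ + 1) / d) * weightedSq 0 ψ := by
  have hd' : (2 : ℝ) < d := by exact_mod_cast hd
  have hγ0 : 0 < γ := by rw [hγ]; linarith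
  have hdγ : (d : ℝ) = 4 * γ + 2 := by rw [hγ]; ring
  set κ : ℝ := γ * (1 - (γ + 1) / d) with hκ
  have hκ0 : 0 ≤ κ := by
    refine mul_nonneg hγ0.le (sub_nonneg.2 ((div_le_one (by linarith)).2 ?_))
    linarith
  have hc2 : Continuous fun x => ‖ψ x‖ ^ 2 := hψ.continuous.norm.pow 2
  have hg := hψ.continuous_gradNormSq
  have key : ∀ ε : ℝ, 0 < ε → γ ^ 2 * ∫ x in cube d, ‖ψ x‖ ^ 2 * regWeight ε x ^ 1
      ≤ (∫ x in cube d, gradNormSq ψ x) + κ * weightedSq 0 ψ := by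
    intro ε hε
    have hc : Continuous (regWeight ε : Space d → ℝ) := (contDiff_regWeight hε (n := 0)).continuous
    have e : (∫ x in cube d, gradNormSq ψ x) + κ * weightedSq 0 ψ
        = ∫ x in cube d, (gradNormSq ψ x + κ * ‖ψ x‖ ^ 2) := by
      have hκc : Continuous fun x => κ * ‖ψ x‖ ^ 2 := continuous_const.mul hc2
      rw [integral_add hg.integrableOn_cube hκc.integrableOn_cube, integral_const_mul]
      simp [weightedSq]
    rw [e, ← integral_const_mul]
    -- The field is `γ |ψ|² q ∇ω`. After the square is split off, `q|ψ|²` has coefficient `γ(d/2 -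
    -- 1) - γ²`, maximal at `γ = (d-2)/4` with value `γ²`; the terms in `ωq` collect into `-κ
    -- ωq|ψ|²`, and `ωq ≤ 1`.
    refine integral_le_of_le_add_hardyDiv hψ 0 γ hε 0 1
      (continuous_const.mul (hc2.mul (hc.pow 1))) (hg.add (continuous_const.mul hc2)) fun x => ?_
    have hq := regWeight_pos hε x
    have h1 := weight_mul_regWeight_le hε x
    have h2 := gradWeightSq_mul_regWeight_le hε x
    have h3 := completed_square_nonneg γ (regWeight ε x) ψ x
    have h4 : 0 ≤ ‖ψ x‖ ^ 2 * ((γ + γ ^ 2) * regWeight ε x *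
        (1 - weight x / d - gradWeightSq x * regWeight ε x)) := by
      refine mul_nonneg (sq_nonneg _) (mul_nonneg (by positivity) (by linarith))
    have h5 : 0 ≤ ‖ψ x‖ ^ 2 * (κ * (1 - weight x * regWeight ε x)) :=
      mul_nonneg (sq_nonneg _) (mul_nonneg hκ0 (by linarith))
    have h6 : gradNormSq ψ x + κ * ‖ψ x‖ ^ 2 + hardyDiv 0 γ ε 0 1 ψ x
        - γ ^ 2 * (‖ψ x‖ ^ 2 * regWeight ε x ^ 1)
        = (gradNormSq ψ x + 2 * (γ * regWeight ε x) * radialTerm ψ x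
            + (γ * regWeight ε x) ^ 2 * (‖ψ x‖ ^ 2 * gradWeightSq x))
          + ‖ψ x‖ ^ 2 * ((γ + γ ^ 2) * regWeight ε x *
              (1 - weight x / d - gradWeightSq x * regWeight ε x))
          + ‖ψ x‖ ^ 2 * (κ * (1 - weight x * regWeight ε x)) := by
      simp only [hardyDiv, hκ]
      rw [hdγ]
      have : 4 * γ + 2 ≠ 0 := by positivity
      field_simp
      push_cast
      ring
    linarith
  have hlim := (tendsto_integral_mul_regWeight_pow hc2 1 (by omega)).const_mul (γ ^ 2)
  exact le_of_tendsto hlim (Eventually.of_forall fun k => key _ (by positivity))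

/-- The weighted Rellich inequality, with a lower order term. -/
lemma rellich_local (hψ : SmoothPeriodic ψ) (n : ℕ) (hd : 4 + 2 * n < d) {γ c σ τ : ℝ}
    (hγ : γ = ((d : ℝ) - 2 * n - 4) / 4) (hc : c = γ + (n + 1) / 2) (hσ : σ = γ * (γ + n + 1))
    (hτ : τ = c - (c * (n + 2) + γ ^ 2) / d) :
    σ ^ 2 * weightedSq (n + 2) ψ
      ≤ weightedSq n (Laplacian.laplacian ψ) + 2 * σ * τ * weightedSq (n + 1) ψ := by
  have hd' : (4 : ℝ) + 2 * n < d := by exact_mod_cast hd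
  have hγ0 : 0 < γ := by rw [hγ]; linarith
  have hdγ : (d : ℝ) = 4 * γ + 2 * n + 4 := by rw [hγ]; ring
  have hc0 : 0 < c := by rw [hc]; positivity
  have hσ0 : 0 < σ := by rw [hσ]; positivity
  have hτ0 : 0 ≤ τ := by
    rw [hτ, sub_nonneg, div_le_iff₀ (by linarith), hdγ, hc]
    nlinarith [mul_nonneg hγ0.le (Nat.cast_nonneg n : (0 : ℝ) ≤ n), sq_nonneg (n : ℝ)]
  have hΔ := hψ.laplacian
  have hc2 : Continuous fun x => ‖ψ x‖ ^ 2 := hψ.continuous.norm.pow 2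
  have hcΔ : Continuous fun x => ‖Laplacian.laplacian ψ x‖ ^ 2 := hΔ.continuous.norm.pow 2
  have key : ∀ ε : ℝ, 0 < ε → σ ^ 2 * ∫ x in cube d, ‖ψ x‖ ^ 2 * regWeight ε x ^ (n + 2)
      ≤ (∫ x in cube d, ‖Laplacian.laplacian ψ x‖ ^ 2 * regWeight ε x ^ n)
        + 2 * σ * τ * ∫ x in cube d, ‖ψ x‖ ^ 2 * regWeight ε x ^ (n + 1) := by
    intro ε hε
    have hcq : Continuous (regWeight ε : Space d → ℝ) :=
      (contDiff_regWeight hε (n := 0)).continuous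
    have hi1 : Continuous fun x => ‖Laplacian.laplacian ψ x‖ ^ 2 * regWeight ε x ^ n :=
      hcΔ.mul (hcq.pow n)
    have hi2 : Continuous fun x => 2 * σ * τ * (‖ψ x‖ ^ 2 * regWeight ε x ^ (n + 1)) :=
      continuous_const.mul (hc2.mul (hcq.pow (n + 1)))
    rw [← integral_const_mul, ← integral_const_mul, ← integral_add hi1.integrableOn_cube
      hi2.integrableOn_cube]
    -- The first part of the field supplies the cross term `2σ q^(n+1) Re(ψ̄Δψ)` of `q^n |Δψ +
    -- σqψ|²` together with `2σ q^(n+1) |∇ψ|²`; the second part completes the latter to `|∇ψ +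
    -- γqψ∇ω|²`.
    refine integral_le_of_le_add_hardyDiv hψ (2 * σ) (2 * σ * c) hε (n + 1) (n + 2)
      (continuous_const.mul (hc2.mul (hcq.pow _)))
      (hi1.add hi2) fun x => ?_
    have hq := regWeight_pos hε x
    have h1 := weight_mul_regWeight_le hε x
    have h2 := gradWeightSq_mul_regWeight_le hε x
    have h3 := completed_square_nonneg γ (regWeight ε x) ψ x
    have h7 : 0 ≤ ‖Laplacian.laplacian ψ x‖ ^ 2
        + 2 * (σ * regWeight ε x) * inner ℝ (ψ x) (Laplacian.laplacian ψ x)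
        + (σ * regWeight ε x) ^ 2 * ‖ψ x‖ ^ 2 := by
      have h8 := norm_add_sq_real (Laplacian.laplacian ψ x) ((σ * regWeight ε x) • ψ x)
      rw [inner_smul_right, norm_smul, mul_pow, real_inner_comm, Real.norm_eq_abs, sq_abs] at h8
      nlinarith [sq_nonneg ‖Laplacian.laplacian ψ x + (σ * regWeight ε x) • ψ x‖]
    have hΔq := mul_nonneg (pow_nonneg hq.le n) h7
    have hSq := mul_nonneg (mul_nonneg (mul_nonneg zero_le_two hσ0.le)
      (pow_nonneg hq.le (n + 1))) h3
    have h4 : 0 ≤ 2 * σ * regWeight ε x ^ (n + 1) * (‖ψ x‖ ^ 2 *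
        ((c * (n + 2) + γ ^ 2) * regWeight ε x *
        (1 - weight x / d - gradWeightSq x * regWeight ε x))) :=
      mul_nonneg (by positivity)
        (mul_nonneg (sq_nonneg _) (mul_nonneg (by positivity) (by linarith)))
    have h5 : 0 ≤ 2 * σ * regWeight ε x ^ (n + 1) *
        (‖ψ x‖ ^ 2 * (τ * (1 - weight x * regWeight ε x))) :=
      mul_nonneg (by positivity) (mul_nonneg (sq_nonneg _) (mul_nonneg hτ0 (by linarith)))
    have h6 : ‖Laplacian.laplacian ψ x‖ ^ 2 * regWeight ε x ^ n
        + 2 * σ * τ * (‖ψ x‖ ^ 2 * regWeight ε x ^ (n + 1))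
        + hardyDiv (2 * σ) (2 * σ * c) ε (n + 1) (n + 2) ψ x
        - σ ^ 2 * (‖ψ x‖ ^ 2 * regWeight ε x ^ (n + 2))
        = regWeight ε x ^ n * (‖Laplacian.laplacian ψ x‖ ^ 2
            + 2 * (σ * regWeight ε x) * inner ℝ (ψ x) (Laplacian.laplacian ψ x)
            + (σ * regWeight ε x) ^ 2 * ‖ψ x‖ ^ 2)
          + 2 * σ * regWeight ε x ^ (n + 1) *
            (gradNormSq ψ x + 2 * (γ * regWeight ε x) * radialTerm ψ x
            + (γ * regWeight ε x) ^ 2 * (‖ψ x‖ ^ 2 * gradWeightSq x))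
          + 2 * σ * regWeight ε x ^ (n + 1) * (‖ψ x‖ ^ 2 *
            ((c * (n + 2) + γ ^ 2) * regWeight ε x *
            (1 - weight x / d - gradWeightSq x * regWeight ε x)))
          + 2 * σ * regWeight ε x ^ (n + 1) *
            (‖ψ x‖ ^ 2 * (τ * (1 - weight x * regWeight ε x)))
          + 2 * σ * regWeight ε x ^ (n + 2) * ‖ψ x‖ ^ 2 *
            (c * d / 2 - c * (n + 2) - γ ^ 2 - σ)
          + 2 * σ * (2 * c - (n + 1) - 2 * γ) * radialTerm ψ x * regWeight ε x ^ (n + 2) := by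
      have hd0 : (d : ℝ) ≠ 0 := by linarith
      have e1 : regWeight ε x ^ (n + 2 + 1) = regWeight ε x ^ n * regWeight ε x ^ 3 := by ring
      have e2 : regWeight ε x ^ (n + 2) = regWeight ε x ^ n * regWeight ε x ^ 2 := by ring
      have e4 : regWeight ε x ^ (n + 1) = regWeight ε x ^ n * regWeight ε x := by ring
      simp only [hardyDiv, e1, e2, e4, hτ]
      push_cast
      field_simp
      ring
    -- The choice of `c` cancels the radial terms; subject to it, `γ` maximises `c(d/2 - n - 2) -
    -- γ²`, and `σ` is the maximal value.
    have h9 : c * d / 2 - c * (n + 2) - γ ^ 2 - σ = 0 := by rw [hdγ, hσ, hc]; ring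
    have h10 : 2 * c - (n + 1) - 2 * γ = 0 := by rw [hc]; ring
    rw [h9, h10] at h6
    linarith
  have l1 := (tendsto_integral_mul_regWeight_pow hc2 (n + 2) (by omega)).const_mul (σ ^ 2)
  have l2 := (tendsto_integral_mul_regWeight_pow hc2 (n + 1) (by omega)).const_mul (2 * σ * τ)
  have l3 := tendsto_integral_mul_regWeight_pow hcΔ n (by omega)
  exact le_of_tendsto_of_tendsto' l1 (l3.add l2) fun k => key _ (by positivity)

/-- The Dirichlet energy is controlled by the Laplacian. -/
lemma two_mul_integral_gradNormSq_le (hψ : SmoothPeriodic ψ) :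
    2 * ∫ x in cube d, gradNormSq ψ x
      ≤ weightedSq 0 ψ + weightedSq 0 (Laplacian.laplacian ψ) := by
  have hΔ := hψ.laplacian
  have hc2 : Continuous fun x => ‖ψ x‖ ^ 2 := hψ.continuous.norm.pow 2
  have hcΔ : Continuous fun x => ‖Laplacian.laplacian ψ x‖ ^ 2 := hΔ.continuous.norm.pow 2
  simp only [weightedSq, pow_zero, div_one]
  rw [← integral_const_mul, ← integral_add hc2.integrableOn_cube hcΔ.integrableOn_cube]
  -- The field is `2 Re(ψ̄∇ψ)`. All powers of `q` in it are zero, so `ε = 1` is an arbitrary choice;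
  -- positivity of `|ψ + Δψ|²` finishes.
  refine integral_le_of_le_add_hardyDiv hψ 2 0 one_pos 0 0
    (continuous_const.mul hψ.continuous_gradNormSq) (hc2.add hcΔ) fun x => ?_
  have h := norm_add_sq_real (ψ x) (Laplacian.laplacian ψ x)
  have h2 := sq_nonneg ‖ψ x + Laplacian.laplacian ψ x‖
  simp only [hardyDiv]
  push_cast
  linarith

end TorusHardy

namespace TorusHardy

open MeasureTheory Set Filter Topology
open scoped Pointwise

/-! ### The Poincaré inequality -/

variable {d : ℕ}

/-- The normalised Haar measure on the unit circle. -/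
noncomputable local instance instMeasureSpaceUnitAddCircle : MeasureSpace UnitAddCircle :=
  ⟨AddCircle.haarAddCircle⟩

local instance instIsProbabilityMeasureUnitAddCircle :
    IsProbabilityMeasure (volume : Measure UnitAddCircle) :=
  inferInstanceAs (IsProbabilityMeasure AddCircle.haarAddCircle)

/-- The character `exp (i n · x)`. -/
noncomputable def character (n : Fin d → ℤ) (x : Space d) : ℂ :=
  Complex.exp (∑ i, (n i : ℂ) * (x i : ℂ) * Complex.I)

/-- The unnormalised Fourier coefficient of a function on the cube. -/
noncomputable def cubeCoeff (f : Space d → ℂ) (n : Fin d → ℤ) : ℂ :=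
  ∫ x in cube d, character (-n) x * f x

lemma contDiff_character (n : Fin d → ℤ) {k : WithTop ℕ∞} : ContDiff ℝ k (character n) := by
  unfold character
  refine ContDiff.cexp (ContDiff.sum fun i _ => (contDiff_const.mul ?_).mul contDiff_const)
  exact Complex.ofRealCLM.contDiff.comp (EuclideanSpace.proj (𝕜 := ℝ) i).contDiff

lemma periodicOnFaces_character (n : Fin d → ℤ) : PeriodicOnFaces (character n) := by
  intro j x _ _
  have h : ∑ i, (n i : ℂ) * ((x + EuclideanSpace.single j (2 * Real.pi)) i : ℂ) * Complex.I
      = ∑ i, (n i : ℂ) * (x i : ℂ) * Complex.I + (n j : ℂ) * (2 * Real.pi * Complex.I) := by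
    have : ∀ i, (n i : ℂ) * ((x + EuclideanSpace.single j (2 * Real.pi)) i : ℂ) * Complex.I
      = (n i : ℂ) * (x i : ℂ) * Complex.I
        + if i = j then (n j : ℂ) * (2 * Real.pi * Complex.I) else 0 := fun i => by
      split_ifs with hij
      · subst hij; simp; ring
      · simp [hij]
    rw [Finset.sum_congr rfl fun i _ => this i, Finset.sum_add_distrib]
    simp
  rw [character, character, h, Complex.exp_add, Complex.exp_int_mul_two_pi_mul_I, mul_one]

lemma hasDerivAt_character_line (n : Fin d → ℤ) (x : Space d) (j : Fin d) :
    HasDerivAt (fun t : ℝ => character n (x + t • basisVec j))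
      ((n j : ℂ) * Complex.I * character n x) 0 := by
  have h : ∀ i : Fin d, HasDerivAt
      (fun t : ℝ => (n i : ℂ) * ((x + t • basisVec j) i : ℂ) * Complex.I)
      (if i = j then (n j : ℂ) * Complex.I else 0) 0 := fun i => by
    split_ifs with hij
    · subst hij
      have := (((hasDerivAt_coord_line x i).ofReal_comp).const_mul (n i : ℂ)).mul_const Complex.I
      simpa using this
    · simp only [PiLp.add_apply, PiLp.smul_apply, PiLp.single_apply, hij, if_false,
        smul_zero, add_zero]
      exact hasDerivAt_const _ _
  have := (HasDerivAt.fun_sum (u := Finset.univ) fun i _ => h i).cexp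
  refine this.congr_deriv ?_
  simp [character]
  ring

/-- Divergence theorem for the field whose only nonzero component is the `j`-th, equal to `exp(-i
n·x) ψ`. -/
lemma cubeCoeff_pderiv {ψ : Space d → ℂ} (hψ : SmoothPeriodic ψ) (j : Fin d) (n : Fin d → ℤ) :
    cubeCoeff (pderiv j ψ) n = (n j : ℂ) * Complex.I * cubeCoeff ψ n := by
  set e := character (-n)
  let V : Fin d → Space d → ℂ := fun i => if i = j then fun x => e x * ψ x else 0
  have he : ContDiff ℝ 1 e := contDiff_character _
  have hψ1 : ContDiff ℝ 1 ψ := hψ.smooth.of_le (by exact_mod_cast le_top)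
  have hV : ∀ i, ContDiff ℝ 1 (V i) := fun i => by
    by_cases h : i = j
    · simpa only [V, h, if_true] using he.mul hψ1
    · simp only [V, h, if_false]
      exact contDiff_const (c := (0 : ℂ))
  have hper : NormalPeriodic V := by
    intro i x hx hxi
    by_cases h : i = j
    · simp only [V, h, if_true]
      subst h
      rw [← hψ.apply_eq i x hx hxi, show e x = e (x + _) from
        periodicOnFaces_character (-n) i x hx hxi]
    · simp [V, h]
  have h0 := integral_divergence_eq_zero hV hper
  have h1 : ∀ x, ∑ i, fderiv ℝ (V i) x (basisVec i)
      = e x * pderiv j ψ x - (n j : ℂ) * Complex.I * (e x * ψ x) := fun x => by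
    rw [Finset.sum_eq_single j (fun i _ hij => by simp [V, hij, Pi.zero_def]) (by simp)]
    have hl := hasDerivAt_line ((hV j).differentiable one_ne_zero x) j
    refine hl.unique ?_
    simp only [V, if_true]
    refine ((hasDerivAt_character_line (-n) x j).mul
      (hasDerivAt_line (hψ1.differentiable one_ne_zero x) j)).congr_deriv ?_
    simp [e]
    ring
  simp only [h1] at h0
  have hc1 : Continuous fun x => e x * pderiv j ψ x := he.continuous.mul (hψ.pderiv j).continuous
  have hc2 : Continuous fun x => (n j : ℂ) * Complex.I * (e x * ψ x) :=
    continuous_const.mul (he.continuous.mul hψ.continuous)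
  rw [integral_sub hc1.integrableOn_cube hc2.integrableOn_cube, integral_const_mul] at h0
  exact sub_eq_zero.1 h0

/-- The function on the torus whose values are those of `f` on the cube. -/
noncomputable def torusLift (f : Space d → ℂ) (t : UnitAddTorus (Fin d)) : ℂ :=
  f (WithLp.toLp 2 ((2 * Real.pi) • fun i => (AddCircle.equivIoc (1 : ℝ) (-(1 / 2)) (t i)).1))

lemma torusLift_coe (f : Space d → ℂ) {y : Fin d → ℝ}
    (hy : ∀ i, y i ∈ Ioc (-(1 / 2) : ℝ) (-(1 / 2) + 1)) :
    torusLift f (fun i => (y i : UnitAddCircle)) = f (WithLp.toLp 2 ((2 * Real.pi) • y)) := by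
  unfold torusLift
  congr 3
  ext i
  exact AddCircle.equivIoc_coe_of_mem (p := (1 : ℝ)) (a := -(1 / 2)) (hy i)

lemma integral_unit_cube_comp {E : Type*} [NormedAddCommGroup E] [NormedSpace ℝ E]
    (g : Space d → E) :
    ∫ y in {y : Fin d → ℝ | ∀ i, y i ∈ Ioc (-(1 / 2) : ℝ) (-(1 / 2) + 1)},
        g (WithLp.toLp 2 ((2 * Real.pi) • y))
      = ((2 * Real.pi) ^ d)⁻¹ • ∫ x in cube d, g x := by
  have hpi := Real.pi_pos
  rw [Measure.setIntegral_comp_smul_of_pos volume (fun y : Fin d → ℝ => g (WithLp.toLp 2 y)) _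
    (by positivity : 0 < 2 * Real.pi), setIntegral_cube_eq]
  have hs : (2 * Real.pi) • {y : Fin d → ℝ | ∀ i, y i ∈ Ioc (-(1 / 2) : ℝ) (-(1 / 2) + 1)}
      = Set.pi univ fun _ => Ioc (-Real.pi) Real.pi := by
    ext y
    rw [Set.mem_smul_set_iff_inv_smul_mem₀ (by positivity)]
    simp only [mem_ofPred_eq, Pi.smul_apply, smul_eq_mul, mem_Ioc, mem_univ_pi]
    refine forall_congr' fun i => ?_
    rw [inv_mul_eq_div, lt_div_iff₀ (by positivity), div_le_iff₀ (by positivity)]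
    constructor <;> rintro ⟨h1, h2⟩ <;> constructor <;> linarith
  have hI : ∫ y in Set.pi univ fun _ : Fin d => Ioc (-Real.pi) Real.pi, g (WithLp.toLp 2 y)
      = ∫ y in Icc (fun _ => -Real.pi) (fun _ => Real.pi), g (WithLp.toLp 2 y) :=
    setIntegral_congr_set Measure.univ_pi_Ioc_ae_eq_Icc
  rw [hs, hI]
  simp

lemma measurable_torusLift {f : Space d → ℂ} (hf : Continuous f) : Measurable (torusLift f) := by
  unfold torusLift
  have h : Measurable fun (t : UnitAddTorus (Fin d)) (i : Fin d) =>
      (AddCircle.equivIoc (1 : ℝ) (-(1 / 2)) (t i)).1 :=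
    measurable_pi_lambda _ fun i => measurable_subtype_coe.comp
      ((AddCircle.measurableEquivIoc (1 : ℝ) (-(1 / 2))).measurable.comp (measurable_pi_apply i))
  exact hf.measurable.comp ((PiLp.continuous_toLp 2 (fun _ : Fin d => ℝ)).measurable.comp
    (h.const_smul (2 * Real.pi)))

lemma exists_bound_torusLift {f : Space d → ℂ} (hf : Continuous f) :
    ∃ C, ∀ t, ‖torusLift f t‖ ≤ C := by
  obtain ⟨C, hC⟩ := (isCompact_closedCube d).exists_bound_of_continuousOn hf.continuousOn
  refine ⟨C, fun t => hC _ fun i => ?_⟩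
  have h := (AddCircle.equivIoc (1 : ℝ) (-(1 / 2)) (t i)).2
  have hpi := Real.pi_pos
  simp only [mem_Ioc] at h
  simp only [Pi.smul_apply, smul_eq_mul, mem_Icc]
  constructor <;> nlinarith

lemma mFourierCoeff_torusLift (f : Space d → ℂ) (n : Fin d → ℤ) :
    UnitAddTorus.mFourierCoeff (torusLift f) n = ((2 * Real.pi) ^ d)⁻¹ • cubeCoeff f n := by
  have h := UnitAddTorus.mFourierCoeff_eq_integral (torusLift f) n (fun _ => -(1 / 2))
  rw [h, cubeCoeff, ← integral_unit_cube_comp]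
  refine setIntegral_congr_fun ?_ fun y hy => ?_
  · exact MeasurableSet.univ_pi' fun i => measurableSet_Ioc
  · simp only [torusLift_coe f hy, smul_eq_mul]
    congr 1
    simp only [UnitAddTorus.mFourier, ContinuousMap.coe_mk, fourier_coe_apply, character,
      Complex.exp_sum]
    refine Finset.prod_congr rfl fun i _ => ?_
    congr 1
    simp
    ring

/-- Parseval on the unit torus. The lift is bounded and measurable, hence square integrable, so no
periodicity of `f` is required. -/
lemma hasSum_sq_cubeCoeff {f : Space d → ℂ} (hf : Continuous f) :
    HasSum (fun n => ‖((2 * Real.pi) ^ d)⁻¹ • cubeCoeff f n‖ ^ 2)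
      (((2 * Real.pi) ^ d)⁻¹ * ∫ x in cube d, ‖f x‖ ^ 2) := by
  obtain ⟨C, hC⟩ := exists_bound_torusLift hf
  have hmem : MemLp (torusLift f) 2 (volume : Measure (UnitAddTorus (Fin d))) :=
    MemLp.of_bound (measurable_torusLift hf).aestronglyMeasurable C (Eventually.of_forall hC)
  have h := UnitAddTorus.hasSum_sq_mFourierCoeff (hmem.toLp _)
  have hae := hmem.coeFn_toLp
  have h1 : ∀ n, UnitAddTorus.mFourierCoeff (hmem.toLp _) n
      = ((2 * Real.pi) ^ d)⁻¹ • cubeCoeff f n := fun n => by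
    rw [← mFourierCoeff_torusLift]
    refine integral_congr_ae ?_
    filter_upwards [hae] with t ht
    rw [ht]
  have h2 : ∫ t, ‖hmem.toLp _ t‖ ^ 2 = ((2 * Real.pi) ^ d)⁻¹ * ∫ x in cube d, ‖f x‖ ^ 2 := by
    have e1 : ∫ t, ‖hmem.toLp _ t‖ ^ 2 = ∫ t, ‖torusLift f t‖ ^ 2 := by
      refine integral_congr_ae ?_
      filter_upwards [hae] with t ht
      rw [ht]
    rw [e1, ← smul_eq_mul, ← integral_unit_cube_comp]
    rw [UnitAddTorus.integral_preimage (fun t => ‖torusLift f t‖ ^ 2) (fun _ => -(1 / 2))]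
    refine setIntegral_congr_fun ?_ fun y hy => ?_
    · exact MeasurableSet.univ_pi' fun i => measurableSet_Ioc
    · simp only [torusLift_coe f hy]
  simp only [h1, h2] at h
  exact h

/-- The Poincaré inequality for periodic functions of zero average. -/
lemma poincare {ψ : Space d → ℂ} (hψ : IsAdmissible ψ) :
    weightedSq 0 ψ ≤ ∫ x in cube d, gradNormSq ψ x := by
  have hp := hψ.smoothPeriodic
  have hpi := Real.pi_pos
  have h1 := hasSum_sq_cubeCoeff hp.continuous
  have h2 := hasSum_sum fun (j : Fin d) (_ : j ∈ Finset.univ) =>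
    hasSum_sq_cubeCoeff (hp.pderiv j).continuous
  have h3 : ∀ n : Fin d → ℤ, ‖((2 * Real.pi) ^ d)⁻¹ • cubeCoeff ψ n‖ ^ 2
      ≤ ∑ j, ‖((2 * Real.pi) ^ d)⁻¹ • cubeCoeff (pderiv j ψ) n‖ ^ 2 := by
    intro n
    -- The zero average kills the zero frequency; any other frequency has some `|n_j| ≥ 1`.
    by_cases hn : n = 0
    · have : cubeCoeff ψ n = 0 := by
        rw [← hψ.zero_average, cubeCoeff, hn]
        simp [character]
      rw [this]
      simp only [smul_zero, norm_zero, ne_eq, OfNat.ofNat_ne_zero, not_false_eq_true, zero_pow]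
      positivity
    · obtain ⟨j, hj⟩ : ∃ j, n j ≠ 0 := by
        by_contra! h
        exact hn (funext h)
      refine le_trans ?_ (Finset.single_le_sum (fun i _ => sq_nonneg _) (Finset.mem_univ j))
      rw [cubeCoeff_pderiv hp]
      refine pow_le_pow_left₀ (norm_nonneg _) ?_ 2
      rw [norm_smul, norm_smul]
      refine mul_le_mul_of_nonneg_left ?_ (norm_nonneg _)
      rw [norm_mul, norm_mul, Complex.norm_I, mul_one]
      refine le_mul_of_one_le_left (norm_nonneg _) ?_
      rw [Complex.norm_intCast]
      exact_mod_cast Int.one_le_abs hj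
  have h4 := hasSum_le h3 h1 h2
  rw [← Finset.mul_sum] at h4
  have h5 := le_of_mul_le_mul_left h4 (by positivity)
  have hc : ∀ j, Continuous fun x => ‖pderiv j ψ x‖ ^ 2 := fun j =>
    (hp.pderiv j).continuous.norm.pow 2
  rw [← integral_finsetSum _ fun j _ => (hc j).integrableOn_cube] at h5
  simpa [weightedSq, gradNormSq_eq_sum_pderiv] using h5

end TorusHardy

namespace TorusHardy

open MeasureTheory Set Filter Topology

/-! ### The constants -/

/-- The reciprocal of the constants `H` and `HR`, as a function of their two ingredients. -/
noncomputable def iterConst (A B : ℤ → ℝ) (d n : ℕ) : ℝ :=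
  ∑ j ∈ Finset.range (n + 1), (d : ℝ) ^ j * A (-(n : ℤ) + j)
      * ∏ i ∈ Finset.range j, B (-(n : ℤ) + i)
    + (d : ℝ) ^ n * ∏ i ∈ Finset.range (n + 1), B (-(n : ℤ) + i)

lemma iterConst_zero (A B : ℤ → ℝ) (d : ℕ) : iterConst A B d 0 = A 0 + B 0 := by
  simp [iterConst]

/-- Splitting off `j = 0` and the factor `i = 0` leaves the same expression for `n`, since `-(n+1) +
(j+1) = -n + j`. -/
lemma iterConst_succ (A B : ℤ → ℝ) (d n : ℕ) :
    iterConst A B d (n + 1)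
      = A (-((n + 1 : ℕ) : ℤ)) + d * B (-((n + 1 : ℕ) : ℤ)) * iterConst A B d n := by
  have e : ∀ j : ℕ, -((n + 1 : ℕ) : ℤ) + ((j + 1 : ℕ) : ℤ) = -(n : ℤ) + j := fun j => by
    push_cast; ring
  unfold iterConst
  rw [Finset.sum_range_succ', Finset.prod_range_succ' _ (n + 1)]
  simp only [e, Finset.prod_range_succ' (fun i : ℕ => B (-((n + 1 : ℕ) : ℤ) + i))]
  simp only [Finset.range_zero, Finset.prod_empty, pow_zero, Nat.cast_zero, add_zero, mul_one,
    one_mul]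
  rw [mul_add, Finset.mul_sum]
  have h : ∀ j ∈ Finset.range (n + 1), (d : ℝ) ^ (j + 1) * A (-(n : ℤ) + j)
      * ((∏ i ∈ Finset.range j, B (-(n : ℤ) + i)) * B (-((n + 1 : ℕ) : ℤ)))
      = d * B (-((n + 1 : ℕ) : ℤ)) * ((d : ℝ) ^ j * A (-(n : ℤ) + j)
        * ∏ i ∈ Finset.range j, B (-(n : ℤ) + i)) := fun j _ => by ring
  rw [Finset.sum_congr rfl h]
  ring

/-- `H(-n, d)⁻¹`. -/
noncomputable def hardyInv (d n : ℕ) : ℝ :=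
  iterConst (fun k => hardyC₁ k d) (fun k => hardyC₂ k d) d n

/-- `HR(-n, d)⁻¹`. -/
noncomputable def hardyRellichInv (d n : ℕ) : ℝ :=
  iterConst (fun k => hardyRellichC₁ k d) (fun k => hardyRellichC₂ k d) d n

lemma hardyConst_neg (d n : ℕ) : hardyConst (-(n : ℤ)) d = (hardyInv d n)⁻¹ := by
  simp [hardyConst, hardyInv, iterConst]

lemma hardyRellichConst_neg (d n : ℕ) :
    hardyRellichConst (-(n : ℤ)) d = (hardyRellichInv d n)⁻¹ := by
  simp [hardyRellichConst, hardyRellichInv, iterConst]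

lemma hardyInv_zero (d : ℕ) :
    hardyInv d 0 = 16 / ((d : ℝ) - 2) ^ 2 + (3 * (d : ℝ) - 2) / (d * (d - 2)) := by
  simp [hardyInv, iterConst_zero, hardyC₁, hardyC₂]

lemma hardyRellichInv_zero (d : ℕ) :
    hardyRellichInv d 0 = 16 / (d : ℝ) ^ 2 + (3 * (d : ℝ) + 4) / (d * d) := by
  simp [hardyRellichInv, iterConst_zero, hardyRellichC₁, hardyRellichC₂]

lemma hardyInv_succ {d : ℕ} (hd : 0 < d) (n : ℕ) :
    hardyInv d (n + 1) = 16 / ((d : ℝ) - 2 * n - 4) ^ 2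
      + (3 * (d : ℝ) - 2 * n - 4) / (d - 2 * n - 4) * hardyInv d n := by
  have hd' : (d : ℝ) ≠ 0 := by positivity
  rw [hardyInv, iterConst_succ, ← hardyInv]
  congr 1
  · simp only [hardyC₁]; push_cast; congr 2; ring
  · congr 1
    simp only [hardyC₂]
    push_cast
    rw [mul_div_assoc', mul_div_mul_left _ _ hd']
    congr 1 <;> ring

lemma hardyRellichInv_succ {d : ℕ} (hd : 0 < d) (n : ℕ) :
    hardyRellichInv d (n + 1) = 16 / ((d : ℝ) + 2 * n + 2) ^ 2
      + (3 * (d : ℝ) + 2 * n + 6) / (d + 2 * n + 2) * hardyRellichInv d n := by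
  have hd' : (d : ℝ) ≠ 0 := by positivity
  rw [hardyRellichInv, iterConst_succ, ← hardyRellichInv]
  congr 1
  · simp only [hardyRellichC₁]; push_cast; congr 2; ring
  · congr 1
    simp only [hardyRellichC₂]
    push_cast
    rw [mul_div_assoc', mul_div_mul_left _ _ hd']
    congr 1 <;> ring

lemma hardyInv_pos {d n : ℕ} (hd : 2 * n + 2 < d) : 0 < hardyInv d n := by
  have hd' : (2 : ℝ) * n + 2 < d := by exact_mod_cast hd
  have hn : (0 : ℝ) ≤ n := by positivity
  induction n with
  | zero =>
    rw [hardyInv_zero]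
    have : (2 : ℝ) < d := by simpa using hd'
    have h1 : (0 : ℝ) < d - 2 := by linarith
    have h2 : (0 : ℝ) < 3 * d - 2 := by linarith
    positivity
  | succ n ih =>
    have := ih (by omega) (by push_cast at hd'; linarith) (by positivity)
    rw [hardyInv_succ (by omega)]
    push_cast at hd' hn
    have h1 : (0 : ℝ) < d - 2 * n - 4 := by linarith
    have h2 : (0 : ℝ) < 3 * d - 2 * n - 4 := by linarith
    positivity

/-- The recursion factor is at least `1`, so the bound propagates from `n = 0`. It gives the slack
used in `const_step` and in the base case of `weightedSq_succ_le`. -/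
lemma three_le_mul_hardyRellichInv {d : ℕ} (hd : 0 < d) (n : ℕ) :
    3 ≤ d * hardyRellichInv d n := by
  have hd' : (0 : ℝ) < d := by exact_mod_cast hd
  induction n with
  | zero =>
    rw [hardyRellichInv_zero]
    have : (d : ℝ) * (16 / (d : ℝ) ^ 2 + (3 * (d : ℝ) + 4) / (d * d)) = 3 + 20 / d := by
      field_simp; ring
    rw [this]
    have : 0 < 20 / (d : ℝ) := by positivity
    linarith
  | succ n ih =>
    rw [hardyRellichInv_succ hd]
    have h1 : 1 ≤ (3 * (d : ℝ) + 2 * n + 6) / (d + 2 * n + 2) := by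
      rw [le_div_iff₀ (by positivity)]; linarith
    have h2 : 0 ≤ (d : ℝ) * (16 / ((d : ℝ) + 2 * n + 2) ^ 2) := by positivity
    have h3 := mul_le_mul_of_nonneg_right h1 (by linarith : 0 ≤ d * hardyRellichInv d n)
    rw [mul_add]
    linarith

lemma hardyRellichInv_pos {d : ℕ} (hd : 0 < d) (n : ℕ) : 0 < hardyRellichInv d n :=
  pos_of_mul_pos_right (lt_of_lt_of_le (by norm_num) (three_le_mul_hardyRellichInv hd n))
    (Nat.cast_nonneg d)

/-- The square root of the leading constant of the Rellich inequality. -/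
noncomputable def rellichLead (d n : ℕ) : ℝ := ((d : ℝ) - 2 * n - 4) * (d + 2 * n) / 16

/-- The constant of the lower order term in the local Rellich inequality. -/
noncomputable def rellichRest (d n : ℕ) : ℝ :=
  (((d : ℝ) - 2) * (d - n - 2) / 4 - (d - 2 * n - 4) ^ 2 / 16) / d

lemma rellichLead_pos {d n : ℕ} (hd : 4 + 2 * n < d) : 0 < rellichLead d n := by
  have hd' : (4 : ℝ) + 2 * n < d := by exact_mod_cast hd
  have : 0 < (d : ℝ) - 2 * n - 4 := by linarith
  have : 0 < (d : ℝ) := by linarith [Nat.cast_nonneg (α := ℝ) n]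
  unfold rellichLead
  positivity

lemma rellichRest_nonneg {d n : ℕ} (hd : 4 + 2 * n < d) : 0 ≤ rellichRest d n := by
  have hd' : (4 : ℝ) + 2 * n < d := by exact_mod_cast hd
  refine div_nonneg ?_ (by positivity)
  obtain ⟨t, ht⟩ : ∃ t : ℝ, (d : ℝ) = 4 + 2 * n + t := ⟨d - 4 - 2 * n, by ring⟩
  have ht0 : 0 < t := by linarith
  rw [ht]
  have hn : (0 : ℝ) ≤ n := by positivity
  have : (4 + 2 * (n : ℝ) + t - 2) * (4 + 2 * n + t - n - 2) / 4
      - (4 + 2 * (n : ℝ) + t - 2 * n - 4) ^ 2 / 16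
      = (2 * n ^ 2 + 3 * n * t + 6 * n + 4 * t + 4) / 4 + 3 * t ^ 2 / 16 := by ring
  rw [this]
  positivity

lemma rellich_local_const {d : ℕ} {ψ : Space d → ℂ} (hψ : SmoothPeriodic ψ) (n : ℕ)
    (hd : 4 + 2 * n < d) :
    rellichLead d n ^ 2 * weightedSq (n + 2) ψ
      ≤ weightedSq n (Laplacian.laplacian ψ)
        + 2 * rellichLead d n * rellichRest d n * weightedSq (n + 1) ψ := by
  refine rellich_local hψ n hd rfl rfl ?_ ?_
  · unfold rellichLead; ring
  · have hd0 : (d : ℝ) ≠ 0 := by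
      have : 0 < d := by omega
      positivity
    unfold rellichRest
    field_simp
    ring

/-- The numerical part of the induction step of `weightedSq_succ_le`. Of the four products in `(A +
Bh)(A' + B'g)`, the term `AB'g` pays for the summand `1` and `BB'hg` for the lower order
coefficient; the other two are dropped. -/
lemma const_step {d n : ℕ} (hd : 6 + 2 * n < d) :
    d * (1 + 2 * rellichLead d n * rellichRest d n * (d * hardyInv d n * hardyRellichInv d n))
      ≤ rellichLead d n ^ 2 * (d * hardyInv d (n + 1) * hardyRellichInv d (n + 1)) := by
  have hd' : (7 : ℝ) + 2 * n ≤ d := by exact_mod_cast (by omega : 7 + 2 * n ≤ d)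
  have hd0 : 0 < d := by omega
  have hdp : (0 : ℝ) < d := by exact_mod_cast hd0
  have hn : (0 : ℝ) ≤ n := by positivity
  have hh := hardyInv_pos (d := d) (n := n) (by omega)
  have hg := hardyRellichInv_pos hd0 n
  have hg3 := three_le_mul_hardyRellichInv hd0 n
  have hσ := rellichLead_pos (d := d) (n := n) (by omega)
  set h := hardyInv d n
  set g := hardyRellichInv d n
  set A : ℝ := 16 / ((d : ℝ) - 2 * n - 4) ^ 2 with hA
  set B : ℝ := (3 * (d : ℝ) - 2 * n - 4) / (d - 2 * n - 4) with hB
  set A' : ℝ := 16 / ((d : ℝ) + 2 * n + 2) ^ 2 with hA'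
  set B' : ℝ := (3 * (d : ℝ) + 2 * n + 6) / (d + 2 * n + 2) with hB'
  have hx : 0 < (d : ℝ) - 2 * n - 4 := by linarith
  have hA0 : 0 < A := by positivity
  have hA'0 : 0 < A' := by positivity
  have hB0 : 0 < B := div_pos (by linarith) hx
  have hB'1 : 1 ≤ B' := by rw [hB', le_div_iff₀ (by positivity)]; linarith
  have h1 : A * B' * g + B * B' * h * g ≤ hardyInv d (n + 1) * hardyRellichInv d (n + 1) := by
    rw [hardyInv_succ hd0, hardyRellichInv_succ hd0]
    have : 0 ≤ A * A' + B * h * A' := by positivity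
    calc A * B' * g + B * B' * h * g ≤ A * A' + B * h * A' + (A * B' * g + B * B' * h * g) := by
          linarith
      _ = (A + B * h) * (A' + B' * g) := by ring
  have h2 : 1 ≤ rellichLead d n ^ 2 * (A * B' * g) := by
    have e : rellichLead d n ^ 2 * A = (d + 2 * n) ^ 2 / 16 := by
      rw [rellichLead, hA]; field_simp
    rw [mul_assoc A, ← mul_assoc, e]
    have e2 : 16 ≤ ((d : ℝ) + 2 * n) ^ 2 * g := by
      have : (d : ℝ) * d ≤ (d + 2 * n) ^ 2 := by nlinarith
      have e3 := mul_le_mul_of_nonneg_right this hg.le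
      have e4 : (d : ℝ) * 3 ≤ d * (d * g) := mul_le_mul_of_nonneg_left hg3 hdp.le
      nlinarith
    have e5 : g ≤ B' * g := le_mul_of_one_le_left hg.le hB'1
    have e6 := mul_le_mul_of_nonneg_left e5 (sq_nonneg ((d : ℝ) + 2 * n))
    rw [div_mul_eq_mul_div, le_div_iff₀ (by norm_num)]
    linarith
  have h3 : 2 * (rellichRest d n * d) ≤ rellichLead d n * (B * B') := by
    have e : rellichRest d n * d
        = ((d : ℝ) - 2) * (d - n - 2) / 4 - (d - 2 * n - 4) ^ 2 / 16 := by
      rw [rellichRest, div_mul_cancel₀ _ hdp.ne']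
    have e2 : rellichLead d n * (B * B')
        = (d + 2 * n) * (3 * (d : ℝ) - 2 * n - 4) * (3 * d + 2 * n + 6)
          / (16 * (d + 2 * n + 2)) := by
      rw [rellichLead, hB, hB']; field_simp
    rw [e, e2, le_div_iff₀ (by positivity)]
    -- In the variables `n, t ≥ 0` the difference of the two sides is a polynomial with nonnegative
    -- coefficients.
    obtain ⟨t, ht⟩ : ∃ t : ℝ, (d : ℝ) = 7 + 2 * n + t := ⟨d - 7 - 2 * n, by ring⟩
    have ht0 : 0 ≤ t := by linarith
    rw [ht, ← sub_nonneg]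
    ring_nf
    positivity
  have h4 := mul_le_mul_of_nonneg_left h3 (by positivity : 0 ≤ rellichLead d n * (h * g))
  have h5 := mul_le_mul_of_nonneg_left h1 (sq_nonneg (rellichLead d n))
  have h6 : 1 + 2 * rellichLead d n * rellichRest d n * (d * h * g)
      ≤ rellichLead d n ^ 2 * (hardyInv d (n + 1) * hardyRellichInv d (n + 1)) := by
    linarith
  calc d * (1 + 2 * rellichLead d n * rellichRest d n * (d * h * g))
      ≤ d * (rellichLead d n ^ 2 * (hardyInv d (n + 1) * hardyRellichInv d (n + 1))) :=
        mul_le_mul_of_nonneg_left h6 hdp.le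
    _ = _ := by ring

/-- The parameter `s = √((u² + v²) / 2)` with `u = n + 1` and `v = (d - 2) / 2`. -/
noncomputable def betaRoot (d n : ℕ) : ℝ :=
  Real.sqrt 2 * Real.sqrt ((d : ℝ) ^ 2 - 4 * d + 4 * n ^ 2 + 8 * n + 8) / 4

lemma rellichBeta_eq (d n : ℕ) :
    rellichBeta (((-(n : ℤ) : ℤ) : ℝ) / 2) d = (betaRoot d n - (n + 1)) / 2 := by
  unfold rellichBeta betaRoot
  push_cast
  have : (d : ℝ) ^ 2 - 4 * d + 16 * (-(n : ℝ) / 2) ^ 2 - 16 * (-(n : ℝ) / 2) + 8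
      = (d : ℝ) ^ 2 - 4 * d + 4 * n ^ 2 + 8 * n + 8 := by ring
  rw [this]
  ring

lemma betaRoot_nonneg (d n : ℕ) : 0 ≤ betaRoot d n := by unfold betaRoot; positivity

lemma betaRoot_sq (d n : ℕ) :
    betaRoot d n ^ 2 = ((n + 1) ^ 2 + (((d : ℝ) - 2) / 2) ^ 2) / 2 := by
  have h : 0 ≤ (d : ℝ) ^ 2 - 4 * d + 4 * n ^ 2 + 8 * n + 8 := by
    have hn : (0 : ℝ) ≤ n := by positivity
    nlinarith [sq_nonneg ((d : ℝ) - 2)]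
  rw [betaRoot, div_pow, mul_pow, Real.sq_sqrt zero_le_two, Real.sq_sqrt h]
  ring

lemma rellichC₁_eq (d n : ℕ) :
    rellichC₁ (((-(n : ℤ) : ℤ) : ℝ) / 2) d
      = (betaRoot d n - (n + 1)) * (d - betaRoot d n) / d := by
  rw [rellichC₁, rellichBeta_eq]
  push_cast
  congr 1
  ring

lemma rellichC₂_eq (d n : ℕ) :
    rellichC₂ (((-(n : ℤ) : ℤ) : ℝ) / 2) d
      = (betaRoot d n - (n + 1)) * (d - 2 + 2 * betaRoot d n) * (d - n - 2) * betaRoot d n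
        / (4 * d) := by
  rw [rellichC₂, rellichBeta_eq]
  push_cast
  rw [show (4 : ℝ) * d = 2 * (2 * d) by ring, ← div_div _ (2 : ℝ) (2 * (d : ℝ))]
  congr 1
  ring

/-- `s` is the quadratic mean of `u = n + 1` and `v = (d-2)/2`, and the dimension hypothesis implies
`u < v`. -/
lemma betaRoot_bounds {d n : ℕ} (hd : 4 + 2 * n < d) :
    (n : ℝ) + 1 < betaRoot d n ∧ betaRoot d n < ((d : ℝ) - 2) / 2 := by
  have hd' : (4 : ℝ) + 2 * n < d := by exact_mod_cast hd
  have hn : (0 : ℝ) ≤ n := by positivity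
  have hs := betaRoot_sq d n
  have hlt : ((n : ℝ) + 1) ^ 2 < (((d : ℝ) - 2) / 2) ^ 2 :=
    pow_lt_pow_left₀ (by linarith) (by positivity) (by norm_num)
  exact ⟨lt_of_pow_lt_pow_left₀ 2 (betaRoot_nonneg d n) (by linarith),
    lt_of_pow_lt_pow_left₀ 2 (by linarith) (by linarith)⟩

lemma rellichC₁_nonneg {d n : ℕ} (hd : 4 + 2 * n < d) :
    0 ≤ rellichC₁ (((-(n : ℤ) : ℤ) : ℝ) / 2) d := by
  have hd' : (4 : ℝ) + 2 * n < d := by exact_mod_cast hd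
  have hn : (0 : ℝ) ≤ n := by positivity
  obtain ⟨h1, h2⟩ := betaRoot_bounds hd
  rw [rellichC₁_eq]
  exact div_nonneg (mul_nonneg (by linarith) (by linarith)) (by linarith)

/-- In terms of `u`, `v`, `s`, the difference of the two sides times `4d` is `(s-u)(2v+s+1)(v-u)²`.
-/
lemma two_mul_lead_mul_rest_le {d n : ℕ} (hd : 4 + 2 * n < d) :
    2 * rellichLead d n * rellichRest d n ≤ rellichC₂ (((-(n : ℤ) : ℤ) : ℝ) / 2) d := by
  have hd' : (4 : ℝ) + 2 * n < d := by exact_mod_cast hd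
  have hn : (0 : ℝ) ≤ n := by positivity
  have hdp : (0 : ℝ) < d := by linarith
  obtain ⟨h1, h2⟩ := betaRoot_bounds hd
  have hs := betaRoot_sq d n
  rw [rellichC₂_eq]
  set s := betaRoot d n
  obtain ⟨v, hv⟩ : ∃ v : ℝ, (d : ℝ) = 2 * v + 2 := ⟨((d : ℝ) - 2) / 2, by ring⟩
  obtain ⟨u, hu⟩ : ∃ u : ℝ, (n : ℝ) = u - 1 := ⟨n + 1, by ring⟩
  have e : 2 * rellichLead d n * rellichRest d n
      = (v ^ 2 - u ^ 2) * (3 * v ^ 2 + 2 * v - u ^ 2) / 2 / (4 * d) := by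
    rw [rellichLead, rellichRest, mul_div_assoc', ← div_div]
    congr 1
    rw [hv, hu]
    ring
  rw [e]
  refine div_le_div_of_nonneg_right ?_ (by positivity)
  rw [hv, hu] at hs
  rw [hv] at h2
  rw [hu] at h1
  have hs' : v ^ 2 = 2 * s ^ 2 - u ^ 2 := by rw [hs]; ring
  have hv0 : 0 < v := by linarith
  have hu0 : 0 < u := by linarith
  have hsu : u < s := by linarith
  have hsv : s < v := by linarith
  have key : 0 ≤ (s - u) * (((2 * v + s) + 1) * (v - u) ^ 2) :=
    mul_nonneg (by linarith) (mul_nonneg (by linarith) (sq_nonneg _))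
  have id : (s - u) * (2 * v + 2 - 2 + 2 * s) * (2 * v + 2 - (u - 1) - 2) * s
      - (v ^ 2 - u ^ 2) * (3 * v ^ 2 + 2 * v - u ^ 2) / 2
      -- The identity holds only modulo `v² = 2s² - u²`, which reduces every power of `v` above the
      -- first.
      = (s - u) * (((2 * v + s) + 1) * (v - u) ^ 2) := by
    have e2 : v ^ 3 = v * (2 * s ^ 2 - u ^ 2) := by rw [← hs']; ring
    have e3 : v ^ 4 = (2 * s ^ 2 - u ^ 2) ^ 2 := by rw [← hs']; ring
    ring_nf
    simp only [e2, e3, hs']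
    ring
  rw [hv, hu]
  linear_combination key - id

end TorusHardy

namespace TorusHardy

open MeasureTheory Set Filter Topology

/-! ### The Hardy and Rellich inequalities -/

variable {d : ℕ} {ψ : Space d → ℂ}

lemma hardy_inequality (hψ : IsAdmissible ψ) (hd : 2 < d) :
    weightedSq 1 ψ ≤ hardyInv d 0 * ∫ x in cube d, gradNormSq ψ x := by
  have hd' : (2 : ℝ) < d := by exact_mod_cast hd
  have h1 := hardy_local hψ.smoothPeriodic hd rfl
  have h2 := poincare hψ
  set G := ∫ x in cube d, gradNormSq ψ x
  set γ : ℝ := ((d : ℝ) - 2) / 4 with hγ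
  have hγ0 : 0 < γ := by rw [hγ]; linarith
  have hκ0 : 0 ≤ γ * (1 - (γ + 1) / d) := by
    refine mul_nonneg hγ0.le (sub_nonneg.2 ((div_le_one (by linarith)).2 ?_))
    rw [hγ]
    linarith
  have h3 : γ ^ 2 * hardyInv d 0 = 1 + γ * (1 - (γ + 1) / d) := by
    rw [hardyInv_zero]
    have e1 : (d : ℝ) - 2 ≠ 0 := by linarith
    have e2 : (d : ℝ) ≠ 0 := by linarith
    rw [hγ]
    field_simp
    ring
  have h4 := mul_le_mul_of_nonneg_left h2 hκ0
  refine le_of_mul_le_mul_left (a := γ ^ 2) ?_ (by positivity)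
  rw [← mul_assoc, h3]
  linarith

lemma integral_gradNormSq_le (hψ : IsAdmissible ψ) :
    ∫ x in cube d, gradNormSq ψ x ≤ weightedSq 0 (Laplacian.laplacian ψ) := by
  have h1 := poincare hψ
  have h2 := two_mul_integral_gradNormSq_le hψ.smoothPeriodic
  linarith

/-- The inequality controlling the lower order term of the local Rellich inequality. -/
lemma weightedSq_succ_le (hψ : IsAdmissible ψ) (n : ℕ) (hd : 4 + 2 * n < d) :
    weightedSq (n + 1) ψ
      ≤ d * hardyInv d n * hardyRellichInv d n * weightedSq n (Laplacian.laplacian ψ) := by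
  have hd0 : 0 < d := by omega
  have hdp : (0 : ℝ) < d := by exact_mod_cast hd0
  induction n with
  | zero =>
    have hD := weightedSq_nonneg 0 (Laplacian.laplacian ψ)
    have hh := hardyInv_pos (d := d) (n := 0) (by omega)
    have h1 := (hardy_inequality hψ (by omega)).trans
      (mul_le_mul_of_nonneg_left (integral_gradNormSq_le hψ) hh.le)
    -- Hardy followed by `∫|∇ψ|² ≤ ∫|Δψ|²` already gives the constant `hardyInv d 0`; the extra
    -- factor `d * hardyRellichInv d 0` is at least `3`.
    have h2 := three_le_mul_hardyRellichInv hd0 0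
    have h3 := mul_le_mul_of_nonneg_right (by linarith : 1 ≤ d * hardyRellichInv d 0)
      (mul_nonneg hh.le hD)
    linarith
  | succ n ih =>
    have h1 := rellich_local_const hψ.smoothPeriodic n (by omega)
    have h2 := ih (by omega)
    -- Both bounds above carry the weight `ω^n` on `Δψ`; one more inverse power of `ω` costs the
    -- factor `d`.
    have h3 := weightedSq_le_succ hψ.smoothPeriodic.laplacian.continuous n (by omega)
    have hσ := rellichLead_pos (d := d) (n := n) (by omega)
    have hτ := rellichRest_nonneg (d := d) (n := n) (by omega)
    have hh := hardyInv_pos (d := d) (n := n) (by omega)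
    have hg := hardyRellichInv_pos hd0 n
    have hD := weightedSq_nonneg (n + 1) (Laplacian.laplacian ψ)
    have h4 := mul_le_mul_of_nonneg_left h2
      (by positivity : 0 ≤ 2 * rellichLead d n * rellichRest d n)
    have h5 := mul_le_mul_of_nonneg_left h3 (by positivity :
      0 ≤ 1 + 2 * rellichLead d n * rellichRest d n * (d * hardyInv d n * hardyRellichInv d n))
    have h6 := mul_le_mul_of_nonneg_right (const_step (d := d) (n := n) (by omega)) hD
    refine le_of_mul_le_mul_left (a := rellichLead d n ^ 2) ?_ (by positivity)
    linarith

/-- The factor in the denominator of the Rellich constant. -/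
noncomputable def rellichDenom (d n : ℕ) : ℝ :=
  1 + hardyRellichInv d n * (d * rellichC₁ (((-(n : ℤ) : ℤ) : ℝ) / 2) d
    + d * rellichC₂ (((-(n : ℤ) : ℤ) : ℝ) / 2) d * hardyInv d n)

lemma rellichConst_neg (d n : ℕ) :
    rellichConst (-(n : ℤ)) d = rellichLead d n ^ 2 / rellichDenom d n := by
  rw [rellichConst, hardyConst_neg, hardyRellichConst_neg, inv_inv, inv_inv, ← rellichDenom,
    mul_comm (256 : ℝ), ← div_div, div_right_comm]
  congr 1
  rw [rellichLead]
  push_cast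
  ring

lemma le_rellichDenom {n : ℕ} (hd : 4 + 2 * n < d) :
    1 + 2 * rellichLead d n * rellichRest d n * (d * hardyInv d n * hardyRellichInv d n)
      ≤ rellichDenom d n := by
  have hd0 : 0 < d := by omega
  have hh := hardyInv_pos (d := d) (n := n) (by omega)
  have hg := hardyRellichInv_pos hd0 n
  have h1 := rellichC₁_nonneg hd
  have h2 := mul_le_mul_of_nonneg_right (two_mul_lead_mul_rest_le hd)
    (by positivity : 0 ≤ d * hardyInv d n * hardyRellichInv d n)
  have h3 : 0 ≤ hardyRellichInv d n * (d * rellichC₁ (((-(n : ℤ) : ℤ) : ℝ) / 2) d) := by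
    positivity
  rw [rellichDenom, mul_add]
  linarith

lemma rellichDenom_pos {n : ℕ} (hd : 4 + 2 * n < d) : 0 < rellichDenom d n := by
  have hh := hardyInv_pos (d := d) (n := n) (by omega)
  have hg := hardyRellichInv_pos (d := d) (by omega) n
  have hσ := rellichLead_pos hd
  have hτ := rellichRest_nonneg hd
  refine lt_of_lt_of_le ?_ (le_rellichDenom hd)
  positivity

lemma rellichConst_neg_nonneg {n : ℕ} (hd : 4 + 2 * n < d) :
    0 ≤ rellichConst (-(n : ℤ)) d := by
  rw [rellichConst_neg]
  exact div_nonneg (sq_nonneg _) (rellichDenom_pos hd).le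

/-- The weighted Rellich inequality. -/
lemma rellich_inequality (hψ : IsAdmissible ψ) (n : ℕ) (hd : 4 + 2 * n < d) :
    rellichConst (-(n : ℤ)) d * weightedSq (n + 2) ψ
      ≤ weightedSq n (Laplacian.laplacian ψ) := by
  have h1 := rellich_local_const hψ.smoothPeriodic n hd
  have h2 := weightedSq_succ_le hψ n hd
  have hσ := rellichLead_pos hd
  have hτ := rellichRest_nonneg hd
  have h3 := mul_le_mul_of_nonneg_left h2
    (by positivity : 0 ≤ 2 * rellichLead d n * rellichRest d n)
  have h4 := mul_le_mul_of_nonneg_right (le_rellichDenom hd)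
    (weightedSq_nonneg n (Laplacian.laplacian ψ))
  rw [rellichConst_neg, div_mul_eq_mul_div, div_le_iff₀ (rellichDenom_pos hd)]
  linarith

/-! ### Iteration of the Rellich inequality. -/

lemma evenConst_eq (m d : ℕ) :
    evenConst m d = ∏ i ∈ Finset.range m, rellichConst (-((2 * i : ℕ) : ℤ)) d := by
  refine Finset.prod_congr rfl fun i _ => ?_
  congr 1

lemma oddConst_eq (m d : ℕ) :
    oddConst m d
      = hardyConst 0 d * ∏ i ∈ Finset.range m, rellichConst (-((2 * i + 1 : ℕ) : ℤ)) d := by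
  rw [oddConst]
  congr 1
  refine Finset.prod_congr rfl fun i _ => ?_
  congr 1
  push_cast
  ring

lemma hardyConst_zero (d : ℕ) : hardyConst 0 d = (hardyInv d 0)⁻¹ := by
  simpa using hardyConst_neg d 0

lemma even_inequality (m : ℕ) (hd : 4 * m < d) (hψ : IsAdmissible ψ) :
    evenConst m d * weightedSq (2 * m) ψ ≤ weightedSq 0 (lapPow m ψ) := by
  rw [evenConst_eq]
  induction m generalizing ψ with
  | zero => simp [lapPow]
  | succ m ih =>
    -- The last factor of the product is used first: it replaces `ψ` by `Δψ` and lowers the power of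
    -- the weight by two.
    have h1 := rellich_inequality hψ (2 * m) (by omega)
    have h2 := ih (by omega) hψ.laplacian
    have h3 : 0 ≤ ∏ i ∈ Finset.range m, rellichConst (-((2 * i : ℕ) : ℤ)) d :=
      Finset.prod_nonneg fun i hi => rellichConst_neg_nonneg (by
        have := Finset.mem_range.1 hi; omega)
    rw [Finset.prod_range_succ, mul_assoc]
    exact (mul_le_mul_of_nonneg_left h1 h3).trans h2

lemma odd_inequality (m : ℕ) (hd : 4 * m + 2 < d) (hψ : IsAdmissible ψ) :
    oddConst m d * weightedSq (2 * m + 1) ψ ≤ ∫ x in cube d, gradNormSq (lapPow m ψ) x := by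
  have hh := hardyInv_pos (d := d) (n := 0) (by omega)
  rw [oddConst_eq, hardyConst_zero]
  induction m generalizing ψ with
  | zero =>
    have := hardy_inequality hψ (by omega)
    simp only [Finset.range_zero, Finset.prod_empty, mul_one]
    rw [inv_mul_le_iff₀ hh]
    exact this
  | succ m ih =>
    have h1 := rellich_inequality hψ (2 * m + 1) (by omega)
    have h2 := ih (by omega) hψ.laplacian
    have h3 : 0 ≤ ∏ i ∈ Finset.range m, rellichConst (-((2 * i + 1 : ℕ) : ℤ)) d :=
      Finset.prod_nonneg fun i hi => rellichConst_neg_nonneg (by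
        have := Finset.mem_range.1 hi; omega)
    rw [Finset.prod_range_succ, ← mul_assoc, mul_assoc _ (rellichConst _ d)]
    exact (mul_le_mul_of_nonneg_left h1 (mul_nonneg (inv_nonneg.2 hh.le) h3)).trans h2

end TorusHardy

namespace TorusHardy

open MeasureTheory Set Filter Topology

/-! ### Asymptotics of the constants in high dimension -/

lemma tendsto_linear_div (a b : ℝ) :
    Tendsto (fun d : ℕ => (a * d + b) / d) atTop (𝓝 a) := by
  have h : Tendsto (fun d : ℕ => a + b / d) atTop (𝓝 (a + 0)) :=
    (tendsto_const_div_atTop_nhds_zero_nat b).const_add a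
  rw [add_zero] at h
  refine h.congr' ?_
  filter_upwards [eventually_gt_atTop 0] with d hd
  have : (d : ℝ) ≠ 0 := by positivity
  field_simp

lemma tendsto_linear_div_linear (a b a' b' : ℝ) (ha' : a' ≠ 0) :
    Tendsto (fun d : ℕ => (a * d + b) / (a' * d + b')) atTop (𝓝 (a / a')) := by
  refine ((tendsto_linear_div a b).div (tendsto_linear_div a' b') ha').congr' ?_
  filter_upwards [eventually_gt_atTop 0] with d hd
  have : (d : ℝ) ≠ 0 := by positivity
  simp only [Pi.div_apply]
  rw [div_div_div_cancel_right₀ this]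

lemma tendsto_mul_div_linear_sq (c b : ℝ) :
    Tendsto (fun d : ℕ => (d : ℝ) * (c / (d + b) ^ 2)) atTop (𝓝 0) := by
  have h := (tendsto_const_div_atTop_nhds_zero_nat c).mul
    ((tendsto_linear_div_linear 1 0 1 b one_ne_zero).pow 2)
  rw [zero_mul] at h
  refine h.congr' ?_
  filter_upwards [eventually_gt_atTop 0] with d hd
  have : (d : ℝ) ≠ 0 := by positivity
  rw [one_mul, add_zero, div_pow]
  field_simp

/-- In the recursion the multiplier tends to `3`, and the additive term is negligible after
multiplication by `d`. -/
lemma tendsto_mul_hardyInv (n : ℕ) :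
    Tendsto (fun d : ℕ => (d : ℝ) * hardyInv d n) atTop (𝓝 (3 ^ (n + 1))) := by
  induction n with
  | zero =>
    have h := (tendsto_mul_div_linear_sq 16 (-2)).add
      (tendsto_linear_div_linear 3 (-2) 1 (-2) one_ne_zero)
    norm_num at h ⊢
    refine h.congr' ?_
    filter_upwards [eventually_gt_atTop 0] with d hd
    have : (d : ℝ) ≠ 0 := by positivity
    rw [hardyInv_zero, mul_add, mul_div_assoc' _ (3 * (d : ℝ) - 2), mul_div_mul_left _ _ this]
    rfl
  | succ n ih =>
    have h := (tendsto_mul_div_linear_sq 16 (-2 * n - 4)).add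
      ((tendsto_linear_div_linear 3 (-2 * n - 4) 1 (-2 * n - 4) one_ne_zero).mul ih)
    have e : 0 + 3 / 1 * 3 ^ (n + 1) = (3 : ℝ) ^ (n + 1 + 1) := by ring
    rw [e] at h
    refine h.congr' ?_
    filter_upwards [eventually_gt_atTop 0] with d hd
    rw [hardyInv_succ hd]
    ring_nf

lemma tendsto_mul_hardyRellichInv (n : ℕ) :
    Tendsto (fun d : ℕ => (d : ℝ) * hardyRellichInv d n) atTop (𝓝 (3 ^ (n + 1))) := by
  induction n with
  | zero =>
    have h := (tendsto_mul_div_linear_sq 16 0).add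
      (tendsto_linear_div_linear 3 4 1 0 one_ne_zero)
    norm_num at h ⊢
    refine h.congr' ?_
    filter_upwards [eventually_gt_atTop 0] with d hd
    have : (d : ℝ) ≠ 0 := by positivity
    rw [hardyRellichInv_zero, mul_add, mul_div_assoc' _ (3 * (d : ℝ) + 4),
      mul_div_mul_left _ _ this]
  | succ n ih =>
    have h := (tendsto_mul_div_linear_sq 16 (2 * n + 2)).add
      ((tendsto_linear_div_linear 3 (2 * n + 6) 1 (2 * n + 2) one_ne_zero).mul ih)
    have e : 0 + 3 / 1 * 3 ^ (n + 1) = (3 : ℝ) ^ (n + 1 + 1) := by ring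
    rw [e] at h
    refine h.congr' ?_
    filter_upwards [eventually_gt_atTop 0] with d hd
    rw [hardyRellichInv_succ hd]
    ring_nf

lemma tendsto_betaRoot_div (n : ℕ) :
    Tendsto (fun d : ℕ => betaRoot d n / d) atTop (𝓝 (Real.sqrt (1 / 8))) := by
  have h : Tendsto (fun d : ℕ => ((((n : ℝ) + 1) / d) ^ 2 + ((1 / 2 * (d : ℝ) + -1) / d) ^ 2) / 2)
      atTop (𝓝 ((0 ^ 2 + (1 / 2) ^ 2) / 2)) :=
    (((tendsto_const_div_atTop_nhds_zero_nat _).pow 2).add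
      ((tendsto_linear_div (1 / 2) (-1)).pow 2)).div_const 2
  have e : ((0 : ℝ) ^ 2 + (1 / 2) ^ 2) / 2 = 1 / 8 := by norm_num
  rw [e] at h
  refine ((Real.continuous_sqrt.tendsto _).comp h).congr fun d => ?_
  rw [Function.comp_apply, ← Real.sqrt_sq (div_nonneg (betaRoot_nonneg d n) (Nat.cast_nonneg d))]
  congr 1
  rw [div_pow (betaRoot d n), betaRoot_sq]
  ring

lemma tendsto_rellichLead_div (n : ℕ) :
    Tendsto (fun d : ℕ => rellichLead d n / (d : ℝ) ^ 2) atTop (𝓝 (1 / 16)) := by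
  have h := ((tendsto_linear_div 1 (-2 * n - 4)).mul (tendsto_linear_div 1 (2 * n))).div_const 16
  rw [one_mul] at h
  refine h.congr fun d => ?_
  rw [rellichLead, div_mul_div_comm]
  ring

/-- The numerator `rellichLead²` grows like `d⁴`. In the denominator `C₂` grows like `d³` and both
reciprocal constants decay like `1/d`, so the `C₂` term is of order `d²` and dominates the `C₁`
term, of order `d`. -/
lemma exists_tendsto_rellichConst_div (n : ℕ) :
    ∃ c : ℝ, 0 < c ∧
      Tendsto (fun d : ℕ => rellichConst (-(n : ℤ)) d / (d : ℝ) ^ 2) atTop (𝓝 c) := by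
  set L := Real.sqrt (1 / 8)
  have hL : 0 < L := by positivity
  have hs := tendsto_betaRoot_div n
  have hsu := hs.sub (tendsto_const_div_atTop_nhds_zero_nat ((n : ℝ) + 1))
  have h0 := tendsto_const_div_atTop_nhds_zero_nat (1 : ℝ)
  have hC₁ : Tendsto (fun d : ℕ => rellichC₁ (((-(n : ℤ) : ℤ) : ℝ) / 2) d / (d : ℝ) ^ 2)
      atTop (𝓝 0) := by
    have h := (hsu.mul (hs.const_sub 1)).mul h0
    rw [mul_zero] at h
    refine h.congr' ?_
    filter_upwards [eventually_gt_atTop 0] with d hd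
    have : (d : ℝ) ≠ 0 := by positivity
    rw [rellichC₁_eq]
    field_simp
  have hC₂ : Tendsto (fun d : ℕ => rellichC₂ (((-(n : ℤ) : ℤ) : ℝ) / 2) d / (d : ℝ) ^ 3)
      atTop (𝓝 ((L - 0) * (1 + 2 * L) * 1 * L / 4)) := by
    refine ((((hsu.mul ((tendsto_linear_div 1 (-2)).add (hs.const_mul 2))).mul
      (tendsto_linear_div 1 (-n - 2))).mul hs).div_const 4).congr' ?_
    filter_upwards [eventually_gt_atTop 0] with d hd
    have : (d : ℝ) ≠ 0 := by positivity
    rw [rellichC₂_eq]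
    field_simp
    ring
  have hden : Tendsto (fun d : ℕ => rellichDenom d n / (d : ℝ) ^ 2) atTop
      (𝓝 (0 ^ 2 + 3 ^ (n + 1) * (0 + (L - 0) * (1 + 2 * L) * 1 * L / 4 * 3 ^ (n + 1)))) := by
    refine ((h0.pow 2).add ((tendsto_mul_hardyRellichInv n).mul
      (hC₁.add (hC₂.mul (tendsto_mul_hardyInv n))))).congr' ?_
    filter_upwards [eventually_gt_atTop 0] with d hd
    have : (d : ℝ) ≠ 0 := by positivity
    rw [rellichDenom]
    field_simp
  have hpos : 0 < (0 : ℝ) ^ 2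
      + 3 ^ (n + 1) * (0 + (L - 0) * (1 + 2 * L) * 1 * L / 4 * 3 ^ (n + 1)) := by
    rw [sub_zero]; positivity
  refine ⟨_, div_pos (by positivity : (0 : ℝ) < (1 / 16) ^ 2) hpos,
    (((tendsto_rellichLead_div n).pow 2).div hden hpos.ne').congr' ?_⟩
  filter_upwards [eventually_gt_atTop 0] with d hd
  have : (d : ℝ) ≠ 0 := by positivity
  rw [rellichConst_neg, Pi.div_apply, div_pow, div_div_div_eq, div_div]
  rw [show ((d : ℝ) ^ 2) ^ 2 * rellichDenom d n = d ^ 2 * (rellichDenom d n * d ^ 2) by ring,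
    mul_comm (rellichLead d n ^ 2), mul_div_mul_left _ _ (pow_ne_zero 2 this)]

lemma tendsto_hardyConst_zero_div :
    Tendsto (fun d : ℕ => hardyConst 0 d / d) atTop (𝓝 (3 ^ (0 + 1))⁻¹) := by
  refine ((tendsto_mul_hardyInv 0).inv₀ (by norm_num)).congr fun d => ?_
  rw [hardyConst_zero, mul_inv, div_eq_mul_inv, mul_comm]

/-- The indices are arbitrary so as to serve both the even and the odd products. -/
lemma exists_tendsto_prod_rellichConst_div (m : ℕ) (k : ℕ → ℕ) :
    ∃ c : ℝ, 0 < c ∧ Tendsto (fun d : ℕ =>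
      (∏ i ∈ Finset.range m, rellichConst (-(k i : ℤ)) d) / (d : ℝ) ^ (2 * m)) atTop (𝓝 c) := by
  choose c hc ht using exists_tendsto_rellichConst_div
  refine ⟨∏ i ∈ Finset.range m, c (k i), Finset.prod_pos fun i _ => hc _, ?_⟩
  refine (tendsto_finsetProd _ fun i _ => ht (k i)).congr fun d => ?_
  rw [Finset.prod_div_distrib, Finset.prod_const, Finset.card_range, pow_mul]

lemma exists_bounds_of_tendsto_div {f : ℕ → ℝ} {c : ℝ} (hc : 0 < c) (p : ℕ)
    (h : Tendsto (fun d : ℕ => f d / (d : ℝ) ^ p) atTop (𝓝 c)) :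
    ∃ c₁ c₂ : ℝ, 0 < c₁ ∧ 0 < c₂ ∧ ∃ N : ℕ, ∀ d : ℕ, N ≤ d →
      c₁ * (d : ℝ) ^ p ≤ f d ∧ f d ≤ c₂ * (d : ℝ) ^ p := by
  have h1 := h.eventually (Icc_mem_nhds (by linarith : c / 2 < c) (by linarith : c < 2 * c))
  obtain ⟨N, hN⟩ := eventually_atTop.1 (h1.and (eventually_gt_atTop 0))
  refine ⟨c / 2, 2 * c, by positivity, by positivity, N, fun d hd => ?_⟩
  obtain ⟨⟨h2, h3⟩, h4⟩ := hN d hd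
  have : 0 < (d : ℝ) ^ p := by positivity
  exact ⟨(le_div_iff₀ this).1 h2, (div_le_iff₀ this).1 h3⟩

lemma evenConst_bounds (m : ℕ) :
    ∃ c₁ c₂ : ℝ, 0 < c₁ ∧ 0 < c₂ ∧ ∃ N : ℕ, ∀ d : ℕ, N ≤ d →
      c₁ * (d : ℝ) ^ (2 * m) ≤ evenConst m d ∧ evenConst m d ≤ c₂ * (d : ℝ) ^ (2 * m) := by
  obtain ⟨c, hc, h⟩ := exists_tendsto_prod_rellichConst_div m fun i => 2 * i
  refine exists_bounds_of_tendsto_div hc (2 * m) (h.congr fun d => ?_)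
  rw [evenConst_eq]

lemma oddConst_bounds (m : ℕ) :
    ∃ c₁ c₂ : ℝ, 0 < c₁ ∧ 0 < c₂ ∧ ∃ N : ℕ, ∀ d : ℕ, N ≤ d →
      c₁ * (d : ℝ) ^ (2 * m + 1) ≤ oddConst m d ∧
        oddConst m d ≤ c₂ * (d : ℝ) ^ (2 * m + 1) := by
  obtain ⟨c, hc, h⟩ := exists_tendsto_prod_rellichConst_div m fun i => 2 * i + 1
  refine exists_bounds_of_tendsto_div (mul_pos (by positivity) hc) (2 * m + 1)
    ((tendsto_hardyConst_zero_div.mul h).congr fun d => ?_)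
  rw [oddConst_eq, div_mul_div_comm, pow_succ']

end TorusHardy

theorem corollary3p12 (m : ℕ) :
    (∀ d : ℕ, 4 * m < d → ∀ ψ : TorusHardy.Space d → ℂ, TorusHardy.IsAdmissible ψ →
      MeasureTheory.IntegrableOn (fun x => ‖ψ x‖ ^ 2 / TorusHardy.weight x ^ (2 * m))
          (TorusHardy.cube d) ∧
        TorusHardy.evenConst m d *
            ∫ x in TorusHardy.cube d, ‖ψ x‖ ^ 2 / TorusHardy.weight x ^ (2 * m)
          ≤ ∫ x in TorusHardy.cube d, ‖TorusHardy.lapPow m ψ x‖ ^ 2) ∧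
    (∀ d : ℕ, 4 * m + 2 < d → ∀ ψ : TorusHardy.Space d → ℂ, TorusHardy.IsAdmissible ψ →
      MeasureTheory.IntegrableOn (fun x => ‖ψ x‖ ^ 2 / TorusHardy.weight x ^ (2 * m + 1))
          (TorusHardy.cube d) ∧
        TorusHardy.oddConst m d *
            ∫ x in TorusHardy.cube d, ‖ψ x‖ ^ 2 / TorusHardy.weight x ^ (2 * m + 1)
          ≤ ∫ x in TorusHardy.cube d, TorusHardy.gradNormSq (TorusHardy.lapPow m ψ) x) ∧
    (∃ c₁ c₂ : ℝ, 0 < c₁ ∧ 0 < c₂ ∧ ∃ N : ℕ, ∀ d : ℕ, N ≤ d →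
      c₁ * (d : ℝ) ^ (2 * m) ≤ TorusHardy.evenConst m d ∧
        TorusHardy.evenConst m d ≤ c₂ * (d : ℝ) ^ (2 * m)) ∧
    (∃ c₁ c₂ : ℝ, 0 < c₁ ∧ 0 < c₂ ∧ ∃ N : ℕ, ∀ d : ℕ, N ≤ d →
      c₁ * (d : ℝ) ^ (2 * m + 1) ≤ TorusHardy.oddConst m d ∧
        TorusHardy.oddConst m d ≤ c₂ * (d : ℝ) ^ (2 * m + 1)) := by
  refine ⟨fun d hd ψ hψ => ?_, fun d hd ψ hψ => ?_, TorusHardy.evenConst_bounds m,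
    TorusHardy.oddConst_bounds m⟩
  · refine ⟨TorusHardy.integrableOn_div_weight_pow (hψ.smooth.continuous.norm.pow 2) _ (by omega),
      ?_⟩
    simpa [TorusHardy.weightedSq] using TorusHardy.even_inequality m hd hψ
  · refine ⟨TorusHardy.integrableOn_div_weight_pow (hψ.smooth.continuous.norm.pow 2) _ (by omega),
      ?_⟩
    exact TorusHardy.odd_inequality m hd hψ
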